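/- Let $r\ge 2$ and $n$ be integers ($n\ge 0$), and let $\alpha,\beta>0$, $q\ge 0$. The ASEP on $n$ sites (with $\gamma=\delta=0$) is the continuous time Markov chain on $\{0,1\}^n$ in which a particle jumps from an occupied site $i$ to a vacant site $i+1$ at rate $1$ and to a vacant site $i-1$ at rate $q$, a particle is created at site $1$, if vacant, at rate $\alpha$, and a particle at site $n$ is annihilated at rate $\beta$. It has a unique stationary distribution $\mu$; let $Z_\mu(\mathbf x)=\sum_{\eta\in\{0,1\}^n}\mu(\eta)\,x_1^{\eta(1)}\cdots x_n^{\eta(n)}$ be its multivariate partition function. An $r$-colored permutation is a pair $\pi=(\kappa,\sigma)$ with $\sigma\in\mathfrak S_n$ and $\kappa:[n]\to\mathbb Z_r$; these form $\mathbb Z_r\wr\mathfrak S_n$. Its excedance set is $\mathcal X(\pi)=\{i:\sigma(i)>i,\text{ or }\sigma(i)=i\text{ and }\kappa_i\ne 0\}$. A cycle of $\sigma$ (fixed points included) is a zero cycle if its maximal element has color $0$, and a non-zero cycle otherwise; $\mathrm{zc}(\pi)$ and $\mathrm{nc}(\pi)$ are the numbers of zero and of non-zero cycles. For a cycle written as a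 word $Ws$ ending with its minimum or its maximum $s$, define a rooted tree $T(Ws,s)$ recursively: if $W$ is empty, it is the single vertex $s$. Otherwise write $W=W_kx_k\cdots W_1x_1$, where $x_1,\dots,x_k$ are the right-to-left maxima of $W$ if $s$ is the minimum, and the right-to-left minima of $W$ if $s$ is the maximum; the root is $s$, its children are $x_1,\dots,x_k$, and the subtree rooted at $x_j$ is $T(W_jx_j,x_j)$. The tree of $\pi$ on the vertex set $\{0,1,\dots,n+1\}$ has root $0$, with $n+1$ a child of $0$; each zero cycle, with maximum $s$, contributes the subtree $T(\cdot,s)$, with $s$ a child of $0$; each non-zero cycle, with minimum $t$, contributes the subtree $T(\cdot,t)$, with $t$ a child of $n+1$. With $p(i)$ the parent of $i$ in this tree, $\mathrm{yy}(\pi)$ is the number of pairs $1\le i<j\le n$ with $p(j)<i<j<p(i)$. Then $Z_\mu(\mathbf x)$ is a constant multiple of $$\sum_{\pi\in\mathbb Z_r\wr\mathfrak S_n}\left(\frac r\alpha\right)^{\mathrm{zc}(\pi)}\left(\frac r{(r-1)\beta}\right)^{\mathrm{nc}(\pi)}q^{\mathrm{yy}(\pi)}\prod_{i\in\mathcal X(\pi)}x_i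 .$$ In particular, for $\alpha=r$ and $\beta=r/(r-1)$ it is a constant multiple of $$\sum_{\pi\in\mathbb Z_r\wr\mathfrak S_n}q^{\mathrm{yy}(\pi)}\prod_{i\in\mathcal X(\pi)}x_i ,$$ which for $q=1$ is the multivariate $r$-colored Eulerian polynomial $\sum_{\pi}\prod_{i\in\mathcal X(\pi)}x_i$. -/

import Mathlib

/-! ### Exclusion processes on `n` sites

Site `i + 1` of `[n] = {1, …, n}` is represented by `i : Fin n`. -/

/-- A configuration `η ∈ {0,1}^n`; `η i = true` means that the site is occupied. -/
abbrev Config (n : ℕ) : Type := Fin n → Bool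

/-- The total rate at which the exclusion process with jump rates `Q`, birth rates `b` and death
rates `d` goes from the configuration `η` to the configuration `ξ`. A particle at an occupied site
`i` jumps to a vacant site `j` at rate `Q i j`, a particle is born at a vacant site `i` at rate
`b i`, and a particle at an occupied site `i` dies at rate `d i`. -/
noncomputable def exclusionRate {n : ℕ} (Q : Fin n → Fin n → ℝ) (b d : Fin n → ℝ)
    (η ξ : Config n) : ℝ :=
  (∑ i, ∑ j, if η i = true ∧ η j = false ∧ ξ = η ∘ Equiv.swap i j then Q i j else 0)
    + (∑ i, if η i = false ∧ ξ = Function.update η i true then b i else 0)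
    + (∑ i, if η i = true ∧ ξ = Function.update η i false then d i else 0)

/-- `μ` is a stationary distribution of the continuous time Markov chain on the finite state
space `S` with the transition rates `rate`: it is a probability distribution, and the flow into
each state equals the flow out of it. -/
def IsStationaryDistribution {S : Type*} [Fintype S] (rate : S → S → ℝ) (μ : S → ℝ) : Prop :=
  μ ∈ stdSimplex ℝ S ∧ ∀ η, ∑ ξ, μ ξ * rate ξ η = μ η * ∑ ξ, rate η ξ

/-- The jump rates of the ASEP on a line: `1` to the right, `q` to the left. -/
noncomputable def asepJump {n : ℕ} (q : ℝ) (i j : Fin n) : ℝ :=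
  if (j : ℕ) = i + 1 then 1 else if (i : ℕ) = j + 1 then q else 0

/-- The value `l` at the first site plus the value `m` at the last site. -/
noncomputable def boundaryRate {n : ℕ} (l m : ℝ) (i : Fin n) : ℝ :=
  (if (i : ℕ) = 0 then l else 0) + (if (i : ℕ) + 1 = n then m else 0)

/-- The transition rates of the ASEP on `n` sites with parameters `α, β, γ, δ, q`: particles enter
at the first site at rate `α` and at the last site at rate `δ`, and they leave from the first site
at rate `γ` and from the last site at rate `β`. -/
noncomputable def asepRate (n : ℕ) (α β γ δ q : ℝ) : Config n → Config n → ℝ :=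
  exclusionRate (asepJump q) (boundaryRate α δ) (boundaryRate γ β)

/-- The multivariate partition function `∑ μ(η) x₁^η(1) ⋯ xₙ^η(n)`. -/
noncomputable def partitionFunction {n : ℕ} (μ : Config n → ℝ) : MvPolynomial (Fin n) ℝ :=
  ∑ η : Config n, MvPolynomial.C (μ η) * ∏ i, MvPolynomial.X i ^ (η i).toNat

/-! ### Alternative trees of marked cycles -/

/-- Parents in the alternative tree `T(W s, s)` of a marked cycle, written as a word `W s` that
ends with the marked letter `s`, which is the minimum (`isMin = true`) or the maximum
(`isMin = false`) of the letters. The list argument is the word `W` read from right to left.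

If `s` is the minimum, write `W = W_k x_k ⋯ W_1 x_1` where `x_1, …, x_k` are the right-to-left
maxima of `W`; if `s` is the maximum, let them be the right-to-left minima. The root of the tree
is `s`, its children are `x_1, …, x_k`, and the subtree with root `x_j` is `T(W_j x_j, x_j)`. Read
from right to left, `W` starts with `x_1`, the block `W_1` is the longest run of letters after it
that are smaller (respectively larger) than `x_1`, and what remains is `W_k x_k ⋯ W_2 x_2`.

The value is only meaningful if `i` is a letter of `W`. -/
def treeParent {α : Type*} [LinearOrder α] (isMin : Bool) (s : α) (w : List α) (i : α) : α :=
  match w with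
  | [] => s
  | x :: R =>
    let inBlock : α → Bool := fun y => if isMin then decide (y < x) else decide (x < y)
    if i = x then s
    else if i ∈ R.takeWhile inBlock then treeParent (!isMin) x (R.takeWhile inBlock) i
    else treeParent isMin s (R.dropWhile inBlock) i
  termination_by w.length
  decreasing_by
  · exact Nat.lt_succ_of_le (List.takeWhile_prefix _).length_le
  · exact Nat.lt_succ_of_le (List.dropWhile_suffix _).length_le

/-! ### Colored permutations -/

/-- The elements `(κ, σ)` of the wreath product `ℤ_r ≀ 𝔖_n`. -/
abbrev ColoredPerm (r n : ℕ) : Type := (Fin n → ZMod r) × Equiv.Perm (Fin n)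

namespace ColoredPerm

variable {r n : ℕ}

/-- The excedance set `𝒳(π)`. -/
def excedances (π : ColoredPerm r n) : Finset (Fin n) :=
  Finset.univ.filter fun i => i < π.2 i ∨ (π.2 i = i ∧ π.1 i ≠ 0)

/-- The set of letters of the cycle of `σ` that contains `i` (possibly a fixed point). -/
def cycleSet (σ : Equiv.Perm (Fin n)) (i : Fin n) : Finset (Fin n) :=
  Finset.univ.filter fun j => σ.SameCycle i j

theorem cycleSet_nonempty (σ : Equiv.Perm (Fin n)) (i : Fin n) : (cycleSet σ i).Nonempty :=
  ⟨i, by simp [cycleSet, Equiv.Perm.SameCycle.refl]⟩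

/-- The cycles of `σ`, fixed points included, as sets of letters. -/
def cycles (σ : Equiv.Perm (Fin n)) : Finset (Finset (Fin n)) :=
  Finset.univ.image (cycleSet σ)

/-- The maximal element of the cycle has color zero. -/
def IsZeroCycle (κ : Fin n → ZMod r) (c : Finset (Fin n)) : Prop :=
  ∃ m ∈ c, (∀ j ∈ c, j ≤ m) ∧ κ m = 0

instance (κ : Fin n → ZMod r) (c : Finset (Fin n)) : Decidable (IsZeroCycle κ c) :=
  inferInstanceAs (Decidable (∃ m ∈ c, (∀ j ∈ c, j ≤ m) ∧ κ m = 0))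

/-- The number of zero cycles. -/
def zc (π : ColoredPerm r n) : ℕ := ((cycles π.2).filter fun c => IsZeroCycle π.1 c).card

/-- The number of non-zero cycles. -/
def nc (π : ColoredPerm r n) : ℕ := ((cycles π.2).filter fun c => ¬ IsZeroCycle π.1 c).card

/-- If the cycle of `s` is written as a word `W s`, then this is `W`: the letters
`σ(s), σ²(s), …` up to the one before `s`. -/
def cycleWord (σ : Equiv.Perm (Fin n)) (s : Fin n) : List (Fin n) :=
  List.iterate σ (σ s) ((cycleSet σ s).card - 1)

/-- The vertex label in `{1, …, n}` of `i : Fin n`. -/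
def label (i : Fin n) : ℕ := i + 1

/-- The parent of the vertex `i ∈ {1, …, n}` in the tree of `π` on the vertex set
`{0, …, n + 1}`. The root is `0`, and `n + 1` is a child of `0`. Each zero cycle, marked at its
maximum `s`, contributes the subtree `T(c, s)` with root `s`, and `s` is a child of `0`; each
non-zero cycle, marked at its minimum `t`, contributes the subtree `T(c, t)` with root `t`, and `t`
is a child of `n + 1`. -/
def parent (π : ColoredPerm r n) (i : Fin n) : ℕ :=
  let c := cycleSet π.2 i
  let s := c.max' (cycleSet_nonempty π.2 i)
  let t := c.min' (cycleSet_nonempty π.2 i)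
  if IsZeroCycle π.1 c then
    if i = s then 0 else label (treeParent false s (cycleWord π.2 s).reverse i)
  else
    if i = t then n + 1 else label (treeParent true t (cycleWord π.2 t).reverse i)

/-- The number of yin-yang pairs `1 ≤ i < j ≤ n`, that is, `p(j) < i < j < p(i)`. -/
def yy (π : ColoredPerm r n) : ℕ :=
  (Finset.univ.filter fun ij : Fin n × Fin n =>
    ij.1 < ij.2 ∧ parent π ij.2 < label ij.1 ∧ label ij.2 < parent π ij.1).card

end ColoredPerm

/-- `∑ q^{yy(π)} ∏_{i ∈ 𝒳(π)} x_i` over all `r`-colored permutations `π` of `[n]`. -/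
noncomputable def qColoredEulerian (r n : ℕ) [NeZero r] (q : ℝ) : MvPolynomial (Fin n) ℝ :=
  ∑ π : ColoredPerm r n, MvPolynomial.C (q ^ π.yy) * ∏ i ∈ π.excedances, MvPolynomial.X i

/-- The multivariate Eulerian polynomial of `ℤ_r ≀ 𝔖_n`, in terms of excedances. -/
noncomputable def coloredEulerian (r n : ℕ) [NeZero r] : MvPolynomial (Fin n) ℝ :=
  ∑ π : ColoredPerm r n, ∏ i ∈ π.excedances, MvPolynomial.X i

/-! Colored permutations and the stationary measure meet in a third object: alternative trees on
`{0, …, n + 1}`, rooted at `0` with child `n + 1`, in which a vertex whose parent is not the root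
lies strictly between its parent and its grandparent. They are encoded by parent functions on `[n]`
(`IsAlternating`). A tree weighs `a` per child of `0`, `b` per child of `n + 1` and `q` per yin-yang
pair, and it gives the configuration whose particles are the vertices smaller than their parents.

With `a = 1/α` and `b = 1/β`, the total weight `f` of the trees over a configuration satisfies the
relations of the matrix ansatz. If site `1` is vacant, vertex `1` is a leaf at `0`, and deleting it
costs `a`; an occupied last site is symmetric and costs `b`. If `k + 1` is occupied and `k + 2`
vacant, either one of these vertices is a leaf attached to the other and can be deleted, or their
edges point away past each other. In the last case exchanging the two labels gives all trees over
the configuration with the particle moved, and destroys exactly one yin-yang pair. Hence `f(…10…) =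
q f(…01…) + f(…1…) + f(…0…)` (`configWeight_of_occupied_vacant`), and a telescoping argument turns
these relations into stationarity (`balance_of_matrixAnsatz`). The stationary distribution is unique
because the empty configuration is reachable from everywhere.

On the other side, every alternative tree is the tree of some colored permutation
(`IsAlternating.exists_parent_eq`), and under this map excedances are the vertices smaller than
their parents (`mem_excedances_iff`). The tree remembers the permutation and, of the colors, only
whether each cycle maximum has color `0`. A fibre therefore has `r ^ n (1/r) ^ zc ((r-1)/r) ^ nc`
elements (`card_filter_parent_eq`), which converts the weights `r/α` and `r/((r-1)β)` into `1/α` and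
`1/β`. -/

/-! ### Alternative trees -/

section AlternativeTrees

variable {α : Type*} [LinearOrder α]

/-- `x` lies before `y`, in the order of `α` (`b = true`) or in its dual (`b = false`). -/
def DirLT (b : Bool) (x y : α) : Prop := if b then x < y else y < x

instance (b : Bool) (x y : α) : Decidable (DirLT b x y) :=
  inferInstanceAs (Decidable (if b then x < y else y < x))

/-- `x` lies strictly between `y` and `z`. -/
def StrictlyBetween (x y z : α) : Prop := (y < x ∧ x < z) ∨ (z < x ∧ x < y)

theorem dirLT_not {b : Bool} {x y : α} : DirLT (!b) x y ↔ DirLT b y x := by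
  cases b <;> simp [DirLT]

theorem DirLT.trans {b : Bool} {x y z : α} (h : DirLT b x y) (h' : DirLT b y z) :
    DirLT b x z := by
  cases b <;> simp only [DirLT] at * <;> simp at * <;> order

theorem DirLT.ne {b : Bool} {x y : α} (h : DirLT b x y) : x ≠ y := by
  cases b <;> simp only [DirLT] at * <;> simp at * <;> order

theorem DirLT.not_symm {b : Bool} {x y : α} (h : DirLT b x y) : ¬ DirLT b y x := by
  cases b <;> simp only [DirLT] at * <;> simp at * <;> order

theorem dirLT_of_not {b : Bool} {x y : α} (h : ¬ DirLT b y x) (hne : x ≠ y) : DirLT b x y := by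
  cases b <;> simp only [DirLT] at * <;> simp at * <;> order

theorem DirLT.strictlyBetween {b : Bool} {x y z : α} (h : DirLT b y x) (h' : DirLT b x z) :
    StrictlyBetween x z y := by
  cases b <;> simp only [DirLT] at * <;> simp at * <;> simp [StrictlyBetween, *]

theorem StrictlyBetween.dirLT {b : Bool} {x y z : α} (h : StrictlyBetween x y z)
    (hzy : DirLT b z y) : DirLT b x y ∧ DirLT b z x := by
  unfold StrictlyBetween at h
  cases b <;> simp only [DirLT] at * <;> simp at * <;>
    rcases h with h | h <;> constructor <;> order

/-- `p` is a parent function of an alternative tree with root `s` and the other vertices `V`. -/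
structure IsAltTree (b : Bool) (s : α) (V : Finset α) (p : α → α) : Prop where
  lt : ∀ v ∈ V, DirLT b s v
  parent : ∀ v ∈ V, p v = s ∨ (p v ∈ V ∧ StrictlyBetween v (p v) (p (p v)))

/-- A minimal element would lie strictly between two elements of the set, one of which is smaller.
This replaces arguments along chains of ancestors. -/
theorem eq_empty_of_closed {p : α → α} {S : Finset α}
    (h : ∀ v ∈ S, p v ∈ S ∧ StrictlyBetween v (p v) (p (p v))) : S = ∅ := by
  by_contra hS
  obtain ⟨v, hv, hmin⟩ := S.exists_minimal (Finset.nonempty_iff_ne_empty.2 hS)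
  have h1 := (h v hv).1
  have h2 := (h _ h1).1
  have m1 : ¬ p v < v := fun hl => (hmin h1 hl.le).not_gt hl
  have m2 : ¬ p (p v) < v := fun hl => (hmin h2 hl.le).not_gt hl
  rcases (h v hv).2 with h3 | h3
  · exact m1 h3.1
  · exact m2 h3.1

theorem exists_dirLT_minimal (b : Bool) {S : Finset α} (hS : S.Nonempty) :
    ∃ x ∈ S, ∀ y ∈ S, y = x ∨ DirLT b x y := by
  cases b
  · exact ⟨S.max' hS, S.max'_mem hS, fun y hy => by
      simpa [DirLT] using (S.le_max' y hy).eq_or_lt⟩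
  · exact ⟨S.min' hS, S.min'_mem hS, fun y hy => by
      simpa [DirLT, eq_comm] using (S.min'_le y hy).eq_or_lt⟩

/-- If `x` is extremal among its children, then it is extremal among its descendants. -/
theorem dirLT_of_descendant {b : Bool} {x : α} {B : Finset α} {p : α → α}
    (h : ∀ v ∈ B, (p v = x ∧ DirLT b v x) ∨ (p v ∈ B ∧ StrictlyBetween v (p v) (p (p v)))) :
    ∀ v ∈ B, DirLT b v x := by
  intro v hv
  -- It suffices to treat the element `m` farthest in direction `b`. Its parent cannot lie beyond
  -- it, so its grandparent does, and by extremality the grandparent can only be `x`.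
  obtain ⟨m, hm, hmax⟩ := exists_dirLT_minimal (!b) ⟨v, hv⟩
  simp only [dirLT_not] at hmax
  have key : DirLT b m x := by
    rcases h m hm with h1 | ⟨h1, h2⟩
    · exact h1.2
    · have h3 := hmax _ h1
      have h4 : p (p m) = x ∨ p (p m) ∈ B := by
        rcases h _ h1 with h5 | h5
        · exact Or.inl h5.1
        · exact Or.inr h5.1
      rcases h4 with h4 | h4
      · rw [h4] at h2
        unfold StrictlyBetween at h2
        cases b <;> simp only [DirLT] at * <;> simp at * <;> rcases h2 with h2 | h2 <;>
          rcases h3 with h3 | h3 <;> order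
      · have h5 := hmax _ h4
        exfalso
        unfold StrictlyBetween at h2
        cases b <;> simp only [DirLT] at * <;> simp at * <;> rcases h2 with h2 | h2 <;>
          rcases h3 with h3 | h3 <;> rcases h5 with h5 | h5 <;> order
  rcases hmax v hv with h1 | h1
  · exact h1 ▸ key
  · exact h1.trans key

/-! ### Words and trees: recursion on blocks -/

/-- The letters of the first block after `x`. -/
def firstBlock (b : Bool) (x : α) (R : List α) : List α := R.takeWhile fun y => DirLT b y x

/-- The letters after the first block. -/
def laterBlocks (b : Bool) (x : α) (R : List α) : List α := R.dropWhile fun y => DirLT b y x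

theorem firstBlock_append_laterBlocks (b : Bool) (x : α) (R : List α) :
    firstBlock b x R ++ laterBlocks b x R = R := List.takeWhile_append_dropWhile

theorem treeParent_cons (b : Bool) (s x : α) (R : List α) (i : α) :
    treeParent b s (x :: R) i = if i = x then s
      else if i ∈ firstBlock b x R then treeParent (!b) x (firstBlock b x R) i
      else treeParent b s (laterBlocks b x R) i := by
  rw [treeParent]
  have : (fun y => if b then decide (y < x) else decide (x < y)) = fun y => decide (DirLT b y x) := by
    funext y; cases b <;> simp [DirLT]
  simp only [this, firstBlock, laterBlocks]
  congr

theorem dirLT_of_mem_firstBlock {b : Bool} {x v : α} {R : List α} (h : v ∈ firstBlock b x R) :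
    DirLT b v x := by
  simpa using List.mem_takeWhile_imp h

/-- Induction on the blocks of a word. -/
theorem block_induction {C : Bool → α → List α → Prop} (nil : ∀ b s, C b s [])
    (cons : ∀ b s x B D, (x :: (B ++ D)).Nodup → (∀ v ∈ x :: (B ++ D), DirLT b s v) →
      (∀ v ∈ B, DirLT b v x) → (∀ y ∈ D.head?, DirLT b x y) →
      firstBlock b x (B ++ D) = B → laterBlocks b x (B ++ D) = D →
      C (!b) x B → C b s D → C b s (x :: (B ++ D)))
    (b : Bool) (s : α) (w : List α) (hw : w.Nodup) (hs : ∀ v ∈ w, DirLT b s v) : C b s w := by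
  induction hn : w.length using Nat.strong_induction_on generalizing b s w with
  | _ n ih =>
  match w with
  | [] => exact nil b s
  | x :: R =>
    have hR := firstBlock_append_laterBlocks b x R
    have hlen : (firstBlock b x R).length + (laterBlocks b x R).length = R.length := by
      rw [← List.length_append, hR]
    have hB : ∀ v ∈ firstBlock b x R, DirLT b v x := fun v hv => dirLT_of_mem_firstBlock hv
    have hw' := hw
    rw [← hR] at hw'
    simp only [List.length_cons] at hn
    have hnd := (List.nodup_cons.1 hw').2
    have := cons b s x (firstBlock b x R) (laterBlocks b x R) (by rwa [hR]) (by rwa [hR]) hB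
      (by
        intro y hy
        have h1 : ¬ DirLT b y x := by
          have hne : laterBlocks b x R ≠ [] := by rintro h; simp [h] at hy
          have := List.head_dropWhile_not (fun y => decide (DirLT b y x)) hne
          rw [Option.mem_def, List.head?_eq_some_head hne, Option.some_inj] at hy
          rw [← hy]
          exact of_decide_eq_false this
        refine dirLT_of_not h1 ?_
        rintro rfl
        exact (List.nodup_cons.1 hw').1 (List.mem_append_right _ (List.mem_of_mem_head? hy)))
      (by rw [hR]) (by rw [hR])
      (ih _ (by omega) _ _ _ (List.nodup_append.1 hnd).1 (fun v hv => dirLT_not.2 (hB v hv)) rfl)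
      (ih _ (by omega) _ _ _ (List.nodup_append.1 hnd).2.1 (fun v hv => hs v
        (by rw [← hR]; exact List.mem_cons_of_mem _ (List.mem_append_right _ hv))) rfl)
    rwa [hR] at this

section
variable {b : Bool} {s x : α} {B D : List α}

theorem treeParent_head : treeParent b s (x :: D) x = s := by
  rw [treeParent_cons, if_pos rfl]

theorem treeParent_of_mem_left (hw : (x :: (B ++ D)).Nodup) (hB : firstBlock b x (B ++ D) = B)
    {v : α} (hv : v ∈ B) : treeParent b s (x :: (B ++ D)) v = treeParent (!b) x B v := by
  rw [treeParent_cons, hB, if_neg, if_pos hv]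
  rintro rfl
  exact (List.nodup_cons.1 hw).1 (List.mem_append_left _ hv)

theorem treeParent_of_mem_right (hw : (x :: (B ++ D)).Nodup) (hB : firstBlock b x (B ++ D) = B)
    (hD : laterBlocks b x (B ++ D) = D) {v : α} (hv : v ∈ D) :
    treeParent b s (x :: (B ++ D)) v = treeParent b s D v := by
  rw [treeParent_cons, hB, hD, if_neg, if_neg]
  · intro h
    exact (List.nodup_append.1 (List.nodup_cons.1 hw).2).2.2 v h v hv rfl
  · rintro rfl
    exact (List.nodup_cons.1 hw).1 (List.mem_append_right _ hv)

end

/-- The one new case in the recursion is a child of `x` in the block of `x`: the block lies on the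
near side of `x` as seen from `s`, hence between the parent `x` and the grandparent `s`. -/
theorem isAltTree_treeParent (b : Bool) (s : α) (w : List α) (hw : w.Nodup)
    (hs : ∀ v ∈ w, DirLT b s v) : IsAltTree b s w.toFinset (treeParent b s w) := by
  refine block_induction (C := fun b s w => IsAltTree b s w.toFinset (treeParent b s w))
    (fun b s => ⟨by simp, by simp⟩) ?_ b s w hw hs
  intro b s x B D hnd hs hB _ hfB hlD ihB ihD
  refine ⟨fun v hv => hs v (List.mem_toFinset.1 hv), fun v hv => ?_⟩
  rw [List.mem_toFinset, List.mem_cons, List.mem_append] at hv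
  rcases hv with rfl | hv | hv
  · exact Or.inl treeParent_head
  · right
    have e := treeParent_of_mem_left (s := s) hnd hfB hv
    rcases ihB.parent v (List.mem_toFinset.2 hv) with h | ⟨h, h'⟩
    · rw [e, h, treeParent_head]
      exact ⟨by simp, (hs v (by simp [hv])).strictlyBetween (hB v hv)⟩
    · rw [List.mem_toFinset] at h
      rw [e, treeParent_of_mem_left (s := s) hnd hfB h]
      exact ⟨by simp [h], h'⟩
  · have e := treeParent_of_mem_right (s := s) hnd hfB hlD hv
    rcases ihD.parent v (List.mem_toFinset.2 hv) with h | ⟨h, h'⟩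
    · exact Or.inl (e.trans h)
    · right
      rw [List.mem_toFinset] at h
      rw [e, treeParent_of_mem_right (s := s) hnd hfB hlD h]
      exact ⟨by simp [h], h'⟩

/-- Every letter is smaller than its parent if and only if it is smaller than its right
neighbour in the word. -/
theorem isChain_treeParent (b : Bool) (s : α) (w : List α) (hw : w.Nodup)
    (hs : ∀ v ∈ w, DirLT b s v) :
    (s :: w).IsChain fun u v => (v < treeParent b s w v ↔ v < u) := by
  refine block_induction
    (C := fun b s w => (s :: w).IsChain fun u v => (v < treeParent b s w v ↔ v < u))
    (fun b s => by simp) ?_ b s w hw hs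
  intro b s x B D hnd hs hB hhead hfB hlD ihB ihD
  refine List.isChain_cons_cons.2 ⟨by rw [treeParent_head], ?_⟩
  have pB := fun v hv => treeParent_of_mem_left (s := s) (v := v) hnd hfB hv
  have pD := fun v hv => treeParent_of_mem_right (s := s) (v := v) hnd hfB hlD hv
  generalize treeParent b s (x :: (B ++ D)) = p at pB pD ⊢
  rw [← List.cons_append]
  refine List.isChain_append.2 ⟨?_, ?_, ?_⟩
  · refine List.isChain_cons.2 ⟨?_, ?_⟩
    · intro v hv
      rw [pB v (List.mem_of_mem_head? hv)]
      exact (List.isChain_cons.1 ihB).1 v hv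
    · refine ((List.isChain_cons.1 ihB).2).imp_of_mem_imp fun u v _ hv h => ?_
      rwa [pB v hv]
  · refine ((List.isChain_cons.1 ihD).2).imp_of_mem_imp fun u v _ hv h => ?_
    rwa [pD v hv]
  -- Junction of two blocks: `v` is a child of `s`, and `u` lies between `s` and `x` or is `x`,
  -- while `v` lies beyond `x`. So `s` and `u` are on the same side of `v`.
  · intro u hu v hv
    have hvD := List.mem_of_mem_head? hv
    rw [pD v hvD]
    have h1 : treeParent b s D v = s := by
      cases D with
      | nil => simp at hv
      | cons y D' =>
        simp only [List.head?_cons, Option.mem_def, Option.some_inj] at hv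
        rw [hv, treeParent_head]
    have hsv := hs v (by simp [hvD])
    have hxv := hhead v hv
    have hux : u = x ∨ DirLT b u x := by
      have := List.mem_of_mem_getLast? hu
      rcases List.mem_cons.1 this with h | h
      · exact Or.inl h
      · exact Or.inr (hB u h)
    rw [h1]
    cases b <;> simp only [DirLT] at * <;> simp at * <;> rcases hux with h | h <;>
      constructor <;> intro <;> order

/-- Children of the root are met in increasing distance from `s`, so the first letter can be read
off from the tree as the nearest child. -/
theorem eq_or_dirLT_of_treeParent_eq (b : Bool) (s : α) (w : List α) (hw : w.Nodup)
    (hs : ∀ v ∈ w, DirLT b s v) :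
    ∀ v ∈ w, treeParent b s w v = s → ∀ x ∈ w.head?, v = x ∨ DirLT b x v := by
  refine block_induction
    (C := fun b s w => ∀ v ∈ w, treeParent b s w v = s → ∀ x ∈ w.head?, v = x ∨ DirLT b x v)
    (fun b s => by simp) ?_ b s w hw hs
  intro b s x B D hnd hs hB hhead hfB hlD ihB ihD v hv hpv x' hx'
  simp only [List.head?_cons, Option.mem_def, Option.some_inj] at hx'
  subst hx'
  rw [List.mem_cons, List.mem_append] at hv
  rcases hv with rfl | hv | hv
  · exact Or.inl rfl
  · exfalso
    rw [treeParent_of_mem_left hnd hfB hv] at hpv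
    have hnd' := (List.nodup_append.1 (List.nodup_cons.1 hnd).2).1
    have hB' := isAltTree_treeParent (!b) x B hnd' fun v hv => dirLT_not.2 (hB v hv)
    rcases hB'.parent v (List.mem_toFinset.2 hv) with h | ⟨h, -⟩
    · exact (hs x (by simp)).ne (hpv.symm.trans h)
    · rw [hpv, List.mem_toFinset] at h
      exact (hs s (by simp [h])).ne rfl
  · right
    rw [treeParent_of_mem_right hnd hfB hlD hv] at hpv
    cases D with
    | nil => simp at hv
    | cons y D' =>
      have h1 := hhead y (by simp)
      rcases ihD v hv hpv y (by simp) with rfl | h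
      · exact h1
      · exact h1.trans h

/-- The word is determined by its tree. -/
theorem treeParent_injective (b : Bool) (s : α) (w : List α) (hw : w.Nodup)
    (hs : ∀ v ∈ w, DirLT b s v) : ∀ w' : List α, w'.Nodup → w.toFinset = w'.toFinset →
      (∀ v ∈ w, treeParent b s w v = treeParent b s w' v) → w = w' := by
  refine block_induction
    (C := fun b s w => ∀ w' : List α, w'.Nodup → w.toFinset = w'.toFinset →
      (∀ v ∈ w, treeParent b s w v = treeParent b s w' v) → w = w')
    (fun b s w' _ h _ => ((List.toFinset_eq_empty_iff _).1 h.symm).symm) ?_ b s w hw hs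
  intro b s x B D hnd hs hB hhead hfB hlD ihB ihD w' hnd' hset hpar
  have hmem : ∀ v, v ∈ x :: (B ++ D) ↔ v ∈ w' := fun v => by
    rw [← List.mem_toFinset, hset, List.mem_toFinset]
  have hs' : ∀ v ∈ w', DirLT b s v := fun v hv => hs v ((hmem v).2 hv)
  cases w' with
  | nil => exact absurd ((hmem x).1 (by simp)) (by simp)
  | cons x' R' =>
    have hx : x = x' := by
      have h1 := eq_or_dirLT_of_treeParent_eq b s _ hnd' hs' x ((hmem x).1 (by simp))
        (by rw [← hpar x (by simp), treeParent_head]) x' (by simp)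
      have h2 := eq_or_dirLT_of_treeParent_eq b s _ hnd hs x' ((hmem x').2 (by simp))
        (by rw [hpar x' ((hmem x').2 (by simp)), treeParent_head]) x (by simp)
      rcases h1 with h1 | h1
      · exact h1
      · rcases h2 with h2 | h2
        · exact h2.symm
        · exact absurd h2 h1.not_symm
    subst hx
    obtain ⟨B', hB'⟩ : ∃ B', B' = firstBlock b x R' := ⟨_, rfl⟩
    obtain ⟨D', hD'⟩ : ∃ D', D' = laterBlocks b x R' := ⟨_, rfl⟩
    have hR' : R' = B' ++ D' := by rw [hB', hD', firstBlock_append_laterBlocks]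
    subst hR'
    have pB := fun v hv => treeParent_of_mem_left (b := b) (s := s) (v := v) hnd hfB hv
    have pD := fun v hv => treeParent_of_mem_right (b := b) (s := s) (v := v) hnd hfB hlD hv
    have pB' := fun v hv => treeParent_of_mem_left (b := b) (s := s) (v := v) hnd' hB'.symm hv
    have pD' := fun v hv =>
      treeParent_of_mem_right (b := b) (s := s) (v := v) hnd' hB'.symm hD'.symm hv
    have hBlt' : ∀ v ∈ B', DirLT b v x := fun v hv => by
      rw [hB'] at hv; exact dirLT_of_mem_firstBlock hv
    have hxB := (List.nodup_cons.1 hnd).1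
    have hxB' := (List.nodup_cons.1 hnd').1
    have hBD := List.nodup_append.1 (List.nodup_cons.1 hnd).2
    have hBD' := List.nodup_append.1 (List.nodup_cons.1 hnd').2
    have tB := isAltTree_treeParent (!b) x B hBD.1 fun v hv => dirLT_not.2 (hB v hv)
    have tB' := isAltTree_treeParent (!b) x B' hBD'.1 fun v hv => dirLT_not.2 (hBlt' v hv)
    have tD := isAltTree_treeParent b s D hBD.2.1 fun v hv => hs v (by simp [hv])
    have tD' := isAltTree_treeParent b s D' hBD'.2.1 fun v hv => hs' v (by simp [hv])
    have hsnot : ∀ {l : List α}, (∀ v ∈ l, DirLT b s v) → s ∉ l := fun h h' => (h s h').ne rfl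
    -- A letter in the first block of one word and in the later blocks of the other would have its
    -- parent in both as well: a parent `x` on one side is incompatible with a parent in `D'` or
    -- equal to `s` on the other. Such a closed set is empty.
    have e1 : B.toFinset ∩ D'.toFinset = ∅ := by
      refine eq_empty_of_closed (p := treeParent b s (x :: (B ++ D))) fun v hv => ?_
      simp only [Finset.mem_inter, List.mem_toFinset] at hv
      have h1 := pB v hv.1
      have h2 := (hpar v (by simp [hv.1])).trans (pD' v hv.2)
      rcases tB.parent v (by simpa using hv.1) with h3 | ⟨h3, h4⟩ <;>
        rcases tD'.parent v (by simpa using hv.2) with h5 | ⟨h5, -⟩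
      · exact absurd ((h1.trans h3).symm.trans (h2.trans h5)) (hs x (by simp)).ne.symm
      · rw [← h2, h1, h3] at h5
        simp only [List.mem_toFinset] at h5
        exact absurd (List.mem_append_right _ h5) hxB'
      · rw [← h1, h2, h5] at h3
        simp only [List.mem_toFinset] at h3
        exact absurd (show s ∈ x :: (B ++ D) by simp [h3]) (hsnot hs)
      · rw [List.mem_toFinset] at h3
        rw [Finset.mem_inter]
        refine ⟨⟨by rw [h1]; simpa using h3, by rw [h2]; exact h5⟩, ?_⟩
        rw [h1, pB _ h3]; exact h4
    have e2 : D.toFinset ∩ B'.toFinset = ∅ := by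
      refine eq_empty_of_closed (p := treeParent b s (x :: (B ++ D))) fun v hv => ?_
      simp only [Finset.mem_inter, List.mem_toFinset] at hv
      have h1 := pD v hv.1
      have h2 := (hpar v (by simp [hv.1])).trans (pB' v hv.2)
      rcases tD.parent v (by simpa using hv.1) with h3 | ⟨h3, h4⟩ <;>
        rcases tB'.parent v (by simpa using hv.2) with h5 | ⟨h5, -⟩
      · exact absurd ((h1.trans h3).symm.trans (h2.trans h5)) (hs x (by simp)).ne
      · rw [← h2, h1, h3] at h5
        simp only [List.mem_toFinset] at h5
        exact absurd (show s ∈ x :: (B' ++ D') by simp [h5]) (hsnot hs')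
      · rw [← h1, h2, h5] at h3
        simp only [List.mem_toFinset] at h3
        exact absurd (List.mem_append_right _ h3) hxB
      · rw [List.mem_toFinset] at h3
        rw [Finset.mem_inter]
        refine ⟨⟨by rw [h1]; simpa using h3, by rw [h2]; exact h5⟩, ?_⟩
        rw [h1, pD _ h3]; exact h4
    have no1 : ∀ v ∈ B, v ∉ D' := fun v h h' => by
      have : v ∈ B.toFinset ∩ D'.toFinset := by simp [h, h']
      simp [e1] at this
    have no2 : ∀ v ∈ D, v ∉ B' := fun v h h' => by
      have : v ∈ D.toFinset ∩ B'.toFinset := by simp [h, h']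
      simp [e2] at this
    have hxm : ∀ v ∈ B ++ D, v ∈ B' ++ D' := fun v hv => by
      have := (hmem v).1 (List.mem_cons_of_mem _ hv)
      rcases List.mem_cons.1 this with rfl | h
      · exact absurd hv hxB
      · exact h
    have hxm' : ∀ v ∈ B' ++ D', v ∈ B ++ D := fun v hv => by
      have := (hmem v).2 (List.mem_cons_of_mem _ hv)
      rcases List.mem_cons.1 this with rfl | h
      · exact absurd hv hxB'
      · exact h
    have sB : ∀ v, v ∈ B ↔ v ∈ B' := fun v =>
      ⟨fun h => (List.mem_append.1 (hxm v (by simp [h]))).resolve_right (no1 v h),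
       fun h => (List.mem_append.1 (hxm' v (by simp [h]))).resolve_right fun h' => no2 v h' h⟩
    have sD : ∀ v, v ∈ D ↔ v ∈ D' := fun v =>
      ⟨fun h => (List.mem_append.1 (hxm v (by simp [h]))).resolve_left (no2 v h),
       fun h => (List.mem_append.1 (hxm' v (by simp [h]))).resolve_left fun h' => no1 v h' h⟩
    have EB : B = B' := ihB B' hBD'.1 (by ext v; simp [sB]) fun v hv => by
      rw [← pB v hv, hpar v (by simp [hv]), pB' v ((sB v).1 hv)]
    have ED : D = D' := ihD D' hBD'.2.1 (by ext v; simp [sD]) fun v hv => by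
      rw [← pD v hv, hpar v (by simp [hv]), pD' v ((sD v).1 hv)]
    rw [EB, ED]

/-- Every alternative tree is the tree of a word. -/
theorem IsAltTree.exists_word {b : Bool} {s : α} {V : Finset α} {p : α → α}
    (h : IsAltTree b s V p) :
    ∃ w : List α, w.Nodup ∧ w.toFinset = V ∧ ∀ v ∈ V, treeParent b s w v = p v := by
  classical
  induction hn : V.card using Nat.strong_induction_on generalizing b s V with
  | _ n ih =>
  rcases V.eq_empty_or_nonempty with rfl | hV
  · exact ⟨[], by simp⟩
  have hne : (V.filter fun v => p v = s).Nonempty := by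
    by_contra hne
    rw [Finset.not_nonempty_iff_eq_empty, Finset.filter_eq_empty_iff] at hne
    exact hV.ne_empty (eq_empty_of_closed fun v hv => (h.parent v hv).resolve_left (hne hv))
  obtain ⟨x, hx, hxmin⟩ := exists_dirLT_minimal b hne
  simp only [Finset.mem_filter] at hx hxmin
  let r : α → α → Prop := fun a c => a ∈ V ∧ p a = c
  -- `x` is the child of `s` nearest to `s`. Its proper descendants `B` must form the first block,
  -- and the rest `D` the later blocks.
  obtain ⟨B, hB⟩ : ∃ B, B = V.filter fun v => Relation.TransGen r v x := ⟨_, rfl⟩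
  obtain ⟨D, hD⟩ : ∃ D, D = V.filter fun v => ¬ Relation.TransGen r v x ∧ v ≠ x := ⟨_, rfl⟩
  have hBp : ∀ v ∈ B, p v = x ∨ p v ∈ B := fun v hv => by
    rw [hB, Finset.mem_filter] at hv
    obtain ⟨c, ⟨-, rfl⟩, hc⟩ := Relation.TransGen.head'_iff.1 hv.2
    rcases Relation.ReflTransGen.cases_head_iff.1 hc with h1 | ⟨d, h1, h2⟩
    · exact Or.inl h1
    · right
      rw [hB, Finset.mem_filter]
      exact ⟨h1.1, Relation.TransGen.head' h1 h2⟩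
  have hDp : ∀ v ∈ D, p v = s ∨ p v ∈ D := fun v hv => by
    rw [hD, Finset.mem_filter] at hv
    refine (h.parent v hv.1).imp_right fun h1 => ?_
    rw [hD, Finset.mem_filter]
    exact ⟨h1.1, fun h2 => hv.2.1 (Relation.TransGen.head ⟨hv.1, rfl⟩ h2),
      fun h2 => hv.2.1 (Relation.TransGen.single ⟨hv.1, h2⟩)⟩
  have hBV : ∀ v ∈ B, v ∈ V := fun v hv => by rw [hB] at hv; exact (Finset.mem_filter.1 hv).1
  have hDV : ∀ v ∈ D, v ∈ V := fun v hv => by rw [hD] at hv; exact (Finset.mem_filter.1 hv).1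
  have hsV : s ∉ V := fun h' => (h.lt s h').ne rfl
  have hBbtw : ∀ v ∈ B, StrictlyBetween v (p v) (p (p v)) := fun v hv =>
    ((h.parent v (hBV v hv)).resolve_left fun h1 => by
      rcases hBp v hv with h2 | h2
      · exact hsV (by rw [← h1, h2]; exact hx.1)
      · exact hsV (by rw [← h1]; exact hBV _ h2)).2
  have hBlt : ∀ v ∈ B, DirLT b v x := by
    refine dirLT_of_descendant (p := p) fun v hv => ?_
    rcases hBp v hv with h1 | h1
    · have := hBbtw v hv
      rw [h1, hx.2] at this
      exact Or.inl ⟨h1, (this.dirLT (h.lt x hx.1)).1⟩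
    · exact Or.inr ⟨h1, hBbtw v hv⟩
  have hxB : x ∉ B := fun h' => (hBlt x h').ne rfl
  have hxD : x ∉ D := fun h' => by rw [hD] at h'; exact (Finset.mem_filter.1 h').2.2 rfl
  have hBD : ∀ v ∈ B, v ∉ D := fun v hv hv' => by
    rw [hB] at hv; rw [hD] at hv'
    exact (Finset.mem_filter.1 hv').2.1 (Finset.mem_filter.1 hv).2
  have tB : IsAltTree (!b) x B p := ⟨fun v hv => dirLT_not.2 (hBlt v hv), fun v hv =>
    (hBp v hv).imp_right fun h1 => ⟨h1, hBbtw v hv⟩⟩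
  have tD : IsAltTree b s D p := ⟨fun v hv => h.lt v (hDV v hv), fun v hv => by
    rcases hDp v hv with h1 | h1
    · exact Or.inl h1
    · exact (h.parent v (hDV v hv)).imp_right fun h2 => ⟨h1, h2.2⟩⟩
  have cB : B.card < n := hn ▸ Finset.card_lt_card ⟨hBV, fun h' => hxB (h' hx.1)⟩
  have cD : D.card < n := hn ▸ Finset.card_lt_card ⟨hDV, fun h' => hxD (h' hx.1)⟩
  obtain ⟨wB, nB, sB, eB⟩ := ih _ cB tB rfl
  obtain ⟨wD, nD, sD, eD⟩ := ih _ cD tD rfl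
  have mB : ∀ v, v ∈ wB ↔ v ∈ B := fun v => by rw [← sB, List.mem_toFinset]
  have mD : ∀ v, v ∈ wD ↔ v ∈ D := fun v => by rw [← sD, List.mem_toFinset]
  have hnd : (x :: (wB ++ wD)).Nodup := by
    refine List.nodup_cons.2 ⟨?_, List.nodup_append.2 ⟨nB, nD, ?_⟩⟩
    · rw [List.mem_append, mB, mD]; exact fun h' => h'.elim hxB hxD
    · rintro v hv _ hv' rfl
      exact hBD v ((mB v).1 hv) ((mD v).1 hv')
  have hBall : ∀ v ∈ wB, decide (DirLT b v x) = true := fun v hv =>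
    decide_eq_true (hBlt v ((mB v).1 hv))
  -- The first letter of `wD` is a child of `s`, hence beyond `x` by the choice of `x`. This makes
  -- the first block stop exactly at the end of `wB`.
  have hhead : ∀ y ∈ wD.head?, ¬ DirLT b y x := fun y hy => by
    have hyD := (mD y).1 (List.mem_of_mem_head? hy)
    have hpy : p y = s := by
      rw [← eD y hyD]
      cases wD with
      | nil => simp at hy
      | cons z l =>
        simp only [List.head?_cons, Option.mem_def, Option.some_inj] at hy
        rw [hy, treeParent_head]
    rcases hxmin y ⟨hDV y hyD, hpy⟩ with h1 | h1
    · exact absurd (h1 ▸ hyD) hxD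
    · exact h1.not_symm
  have hfB : firstBlock b x (wB ++ wD) = wB := by
    rw [firstBlock, List.takeWhile_append_of_pos hBall]
    cases wD with
    | nil => simp
    | cons z l => simp [hhead z (by simp)]
  have hlD : laterBlocks b x (wB ++ wD) = wD :=
    List.append_cancel_left (as := wB)
      (by conv_rhs => rw [← firstBlock_append_laterBlocks b x (wB ++ wD), hfB])
  have hcover : ∀ v, v ∈ V ↔ v = x ∨ v ∈ B ∨ v ∈ D := fun v => by
    constructor
    · intro hv
      by_cases h1 : v = x
      · exact Or.inl h1
      · by_cases h2 : Relation.TransGen r v x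
        · exact Or.inr (Or.inl (by rw [hB]; exact Finset.mem_filter.2 ⟨hv, h2⟩))
        · exact Or.inr (Or.inr (by rw [hD]; exact Finset.mem_filter.2 ⟨hv, h2, h1⟩))
    · rintro (rfl | h1 | h1)
      exacts [hx.1, hBV v h1, hDV v h1]
  refine ⟨x :: (wB ++ wD), hnd, ?_, fun v hv => ?_⟩
  · ext v
    rw [hcover, List.mem_toFinset, List.mem_cons, List.mem_append, mB, mD]
  · rcases (hcover v).1 hv with rfl | h1 | h1
    · rw [treeParent_head, hx.2]
    · rw [treeParent_of_mem_left hnd hfB ((mB v).2 h1), eB v h1]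
    · rw [treeParent_of_mem_right hnd hfB hlD ((mD v).2 h1), eD v h1]

end AlternativeTrees

/-! ### Alternating parent functions on `[n]` -/

/-- The functions `p : [n] → {0, …, n + 1}` that are the parent functions of alternative trees on
`{0, …, n + 1}` with root `0`. -/
def IsAlternating {n : ℕ} (p : Fin n → ℕ) : Prop :=
  ∀ i, p i ≤ n + 1 ∧ p i ≠ ColoredPerm.label i ∧ ∀ j, p i = ColoredPerm.label j →
    StrictlyBetween (ColoredPerm.label i) (ColoredPerm.label j) (p j)

theorem IsAlternating.eq_empty_of_closed {n : ℕ} {p : Fin n → ℕ} (hp : IsAlternating p)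
    {S : Finset (Fin n)} (h : ∀ i ∈ S, ∃ j ∈ S, p i = ColoredPerm.label j) : S = ∅ := by
  by_contra hS
  obtain ⟨v, hv, hmin⟩ := S.exists_minimal (Finset.nonempty_iff_ne_empty.2 hS)
  obtain ⟨j, hj, hvj⟩ := h v hv
  obtain ⟨k, hk, hjk⟩ := h j hj
  have h1 := (hp v).2.2 j hvj
  rw [hjk] at h1
  have m1 : ¬ j < v := fun hl => (hmin hj hl.le).not_gt hl
  have m2 : ¬ k < v := fun hl => (hmin hk hl.le).not_gt hl
  simp only [StrictlyBetween, ColoredPerm.label] at h1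
  rw [Fin.lt_def] at m1 m2
  omega

/-! ### From colored permutations to alternative trees -/

namespace ColoredPerm

section CycleWords

variable {n : ℕ} (σ : Equiv.Perm (Fin n))

theorem label_injective : Function.Injective (label : Fin n → ℕ) := fun i j h => by
  simpa [label, Fin.ext_iff] using h

theorem mem_cycleSet {i j : Fin n} : j ∈ cycleSet σ i ↔ σ.SameCycle i j := by simp [cycleSet]

theorem self_mem_cycleSet (i : Fin n) : i ∈ cycleSet σ i := (mem_cycleSet σ).2 (.refl _ _)

theorem cycleSet_eq {i j : Fin n} (h : σ.SameCycle i j) : cycleSet σ i = cycleSet σ j := by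
  ext k
  rw [mem_cycleSet, mem_cycleSet]
  exact ⟨h.symm.trans, h.trans⟩

theorem cycleSet_eq_of_mem {i j : Fin n} (h : j ∈ cycleSet σ i) : cycleSet σ j = cycleSet σ i :=
  (cycleSet_eq σ ((mem_cycleSet σ).1 h)).symm

theorem minimalPeriod_pos (i : Fin n) : 0 < Function.minimalPeriod σ i :=
  Function.minimalPeriod_pos_of_mem_periodicPts
    (Function.Injective.mem_periodicPts σ.injective i)

theorem cycleSet_eq_image (i : Fin n) : cycleSet σ i =
    (Finset.range (Function.minimalPeriod σ i)).image fun k => σ^[k] i := by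
  ext j
  rw [mem_cycleSet, Finset.mem_image]
  constructor
  · intro h
    obtain ⟨k, -, hk⟩ := h.exists_pow_eq''
    refine ⟨k % Function.minimalPeriod σ i,
      Finset.mem_range.2 (Nat.mod_lt _ (minimalPeriod_pos σ i)), ?_⟩
    simp only [Function.iterate_mod_minimalPeriod_eq, ← hk.2, Equiv.Perm.iterate_eq_pow]
  · rintro ⟨k, -, rfl⟩
    exact ⟨k, by simp [Equiv.Perm.iterate_eq_pow]⟩

theorem card_cycleSet (i : Fin n) : (cycleSet σ i).card = Function.minimalPeriod σ i := by
  rw [cycleSet_eq_image, Finset.card_image_of_injOn, Finset.card_range]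
  intro a ha b hb h
  exact Function.iterate_injOn_Iio_minimalPeriod (by simpa using ha) (by simpa using hb) h

theorem cycleSet_inv (i : Fin n) : cycleSet σ⁻¹ i = cycleSet σ i := by
  ext j; simp [mem_cycleSet]

theorem iterate_card_cycleSet (i : Fin n) : σ^[(cycleSet σ i).card] i = i := by
  rw [card_cycleSet]; exact Function.iterate_minimalPeriod

theorem card_cycleSet_pos (i : Fin n) : 0 < (cycleSet σ i).card :=
  Finset.card_pos.2 (cycleSet_nonempty σ i)

/-- `treeParent` reads words from right to left, so the marked letter comes first and each step
backwards along the cycle is an application of `σ⁻¹`. -/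
theorem cons_reverse_cycleWord (s : Fin n) :
    s :: (cycleWord σ s).reverse = List.iterate (σ⁻¹ : Equiv.Perm _) s (cycleSet σ s).card := by
  have hpos := card_cycleSet_pos σ s
  apply List.ext_getElem
  · simp [cycleWord]; omega
  · intro k h1 h2
    rw [List.getElem_iterate]
    cases k with
    | zero => simp
    | succ k =>
      simp only [List.length_iterate] at h2
      rw [List.getElem_cons_succ, List.getElem_reverse]
      simp only [cycleWord, List.getElem_iterate, List.length_iterate]
      rw [← Function.iterate_succ_apply]
      apply σ.injective.iterate (k + 1)
      rw [← Function.iterate_add_apply,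
        (Function.RightInverse.iterate (f := σ) (g := (σ⁻¹ : Equiv.Perm _))
          (fun x => by simp) (k + 1)) s]
      conv_rhs => rw [← iterate_card_cycleSet σ s]
      congr 1
      omega

theorem toFinset_iterate (s : Fin n) :
    (List.iterate σ s (cycleSet σ s).card).toFinset = cycleSet σ s := by
  conv_rhs => rw [cycleSet_eq_image]
  ext j
  simp only [List.mem_toFinset, List.mem_iterate, Finset.mem_image, Finset.mem_range,
    card_cycleSet]
  constructor <;> rintro ⟨k, hk, rfl⟩ <;> exact ⟨k, hk, rfl⟩

theorem nodup_cons_reverse_cycleWord (s : Fin n) : (s :: (cycleWord σ s).reverse).Nodup := by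
  rw [← Multiset.coe_nodup, ← Multiset.toFinset_card_eq_card_iff_nodup, Multiset.coe_card,
    List.toFinset_coe, cons_reverse_cycleWord, ← cycleSet_inv,
    toFinset_iterate, List.length_iterate]

theorem mem_reverse_cycleWord {s i : Fin n} :
    i ∈ (cycleWord σ s).reverse ↔ i ∈ cycleSet σ s ∧ i ≠ s := by
  have h := nodup_cons_reverse_cycleWord σ s
  have h2 : i ∈ s :: (cycleWord σ s).reverse ↔ i ∈ cycleSet σ s := by
    rw [cons_reverse_cycleWord, ← List.mem_toFinset, ← cycleSet_inv, toFinset_iterate]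
  rw [← h2, List.mem_cons]
  have := (List.nodup_cons.1 h).1
  constructor
  · intro h'
    exact ⟨Or.inr h', by rintro rfl; exact this h'⟩
  · rintro ⟨h' | h', h''⟩
    exacts [absurd h' h'', h']

theorem isChain_cons_reverse_cycleWord (s : Fin n) :
    (s :: (cycleWord σ s).reverse).IsChain fun u v => u = σ v := by
  rw [cons_reverse_cycleWord, List.isChain_iff_getElem]
  intro i hi
  simp only [List.getElem_iterate, Function.iterate_succ_apply']
  simp

end CycleWords

variable {r n : ℕ} (π : ColoredPerm r n)

/-- The marked letter of the cycle of `i` is its minimum. -/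
def markedMin (i : Fin n) : Bool := !decide (IsZeroCycle π.1 (cycleSet π.2 i))

/-- The marked letter of the cycle of `i`. -/
def root (i : Fin n) : Fin n :=
  if IsZeroCycle π.1 (cycleSet π.2 i) then (cycleSet π.2 i).max' (cycleSet_nonempty _ _)
  else (cycleSet π.2 i).min' (cycleSet_nonempty _ _)

theorem root_mem (i : Fin n) : root π i ∈ cycleSet π.2 i := by
  unfold root; split_ifs
  exacts [Finset.max'_mem _ _, Finset.min'_mem _ _]

theorem root_eq_of_cycleSet_eq {i j : Fin n} (h : cycleSet π.2 i = cycleSet π.2 j) :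
    root π i = root π j := by
  simp only [root, h]

theorem markedMin_eq_of_cycleSet_eq {i j : Fin n} (h : cycleSet π.2 i = cycleSet π.2 j) :
    markedMin π i = markedMin π j := by
  simp only [markedMin, h]

theorem cycleSet_root (i : Fin n) : cycleSet π.2 (root π i) = cycleSet π.2 i :=
  cycleSet_eq_of_mem _ (root_mem π i)

theorem root_eq_iff {i j : Fin n} : root π i = root π j ↔ cycleSet π.2 i = cycleSet π.2 j :=
  ⟨fun h => by rw [← cycleSet_root, h, cycleSet_root], root_eq_of_cycleSet_eq π⟩

/-- The parent function within the tree of the cycle of `i`. -/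
def innerParent (i : Fin n) : Fin n → Fin n :=
  treeParent (markedMin π i) (root π i) (cycleWord π.2 (root π i)).reverse

theorem parent_eq (i : Fin n) : parent π i =
    if i = root π i then (if markedMin π i then n + 1 else 0)
    else label (innerParent π i i) := by
  simp only [parent, root, markedMin, innerParent]
  by_cases h : IsZeroCycle π.1 (cycleSet π.2 i) <;> simp [h]

theorem dirLT_root {i v : Fin n} (hv : v ∈ (cycleWord π.2 (root π i)).reverse) :
    DirLT (markedMin π i) (root π i) v := by
  rw [mem_reverse_cycleWord, cycleSet_root] at hv
  simp only [markedMin, root, DirLT] at hv ⊢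
  by_cases h : IsZeroCycle π.1 (cycleSet π.2 i)
  · simp only [h, if_true] at hv ⊢
    simpa using lt_of_le_of_ne (Finset.le_max' _ _ hv.1) hv.2
  · simp only [h, if_false] at hv ⊢
    simpa using lt_of_le_of_ne (Finset.min'_le _ _ hv.1) hv.2.symm

theorem isAltTree_innerParent (i : Fin n) :
    IsAltTree (markedMin π i) (root π i) ((cycleSet π.2 i).erase (root π i))
      (innerParent π i) := by
  have h := isAltTree_treeParent (markedMin π i) (root π i) (cycleWord π.2 (root π i)).reverse
    (List.nodup_cons.1 (nodup_cons_reverse_cycleWord _ _)).2 fun v hv => dirLT_root π hv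
  rw [innerParent]
  convert h using 1
  ext v
  rw [List.mem_toFinset, mem_reverse_cycleWord, cycleSet_root, Finset.mem_erase, and_comm]

theorem innerParent_congr {i j : Fin n} (h : j ∈ cycleSet π.2 i) :
    innerParent π j = innerParent π i := by
  have h' := cycleSet_eq_of_mem _ h
  simp only [innerParent, root_eq_of_cycleSet_eq π h', markedMin_eq_of_cycleSet_eq π h']

theorem innerParent_mem {i : Fin n} (h : i ≠ root π i) : innerParent π i i ∈ cycleSet π.2 i := by
  rcases (isAltTree_innerParent π i).parent i
    (Finset.mem_erase.2 ⟨h, self_mem_cycleSet _ _⟩) with h1 | h1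
  · rw [h1]; exact root_mem π i
  · exact (Finset.mem_erase.1 h1.1).2

/-- Within a cycle this is `isAltTree_innerParent`. For children of the marked letter the outer edge
matters: a maximum hangs from `0` and a minimum from `n + 1`, so that all other letters of the cycle
lie between the marked letter and its parent. -/
theorem isAlternating_parent : IsAlternating (parent π) := by
  intro i
  by_cases hi : i = root π i
  · have h : parent π i = if markedMin π i then n + 1 else 0 := by rw [parent_eq, if_pos hi]
    have hl : ∀ j : Fin n, parent π i ≠ label j := fun j => by
      rw [h]; simp only [label]; split_ifs <;> omega
    exact ⟨by rw [h]; split_ifs <;> omega, hl i, fun j hj => absurd hj (hl j)⟩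
  · have h : parent π i = label (innerParent π i i) := by rw [parent_eq, if_neg hi]
    have hm := innerParent_mem π hi
    have hbtw : StrictlyBetween (label i) (parent π i) (parent π (innerParent π i i)) := by
      have hr := root_eq_of_cycleSet_eq π (cycleSet_eq_of_mem _ hm)
      have hmm := markedMin_eq_of_cycleSet_eq π (cycleSet_eq_of_mem _ hm)
      have ht := isAltTree_innerParent π i
      have hi' := Finset.mem_erase.2 ⟨hi, self_mem_cycleSet π.2 i⟩
      rw [h, parent_eq π (innerParent π i i), hr, innerParent_congr π hm, hmm]
      rcases ht.parent i hi' with h1 | ⟨h1, h2⟩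
      · rw [if_pos h1, h1]
        have h3 := ht.lt i hi'
        cases hb : markedMin π i <;> simp only [hb, DirLT] at h3 <;> simp at h3 <;>
          simp [StrictlyBetween, label] <;> omega
      · rw [if_neg (Finset.mem_erase.1 h1).1]
        simp only [StrictlyBetween, label, Fin.lt_def] at h2 ⊢
        omega
    refine ⟨by rw [h]; simp only [label]; omega, ?_, fun j hj => ?_⟩
    · unfold StrictlyBetween at hbtw; omega
    · have : j = innerParent π i i := label_injective (hj.symm.trans h)
      rw [← hj, this]; exact hbtw

theorem isZeroCycle_cycleSet_iff (i : Fin n) : IsZeroCycle π.1 (cycleSet π.2 i) ↔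
    π.1 ((cycleSet π.2 i).max' (cycleSet_nonempty _ _)) = 0 := by
  constructor
  · rintro ⟨m, hm, hmax, h0⟩
    have : (cycleSet π.2 i).max' (cycleSet_nonempty _ _) = m :=
      le_antisymm (Finset.max'_le _ _ _ hmax) (Finset.le_max' _ _ hm)
    rwa [this]
  · intro h
    exact ⟨_, Finset.max'_mem _ _, fun j hj => Finset.le_max' _ _ hj, h⟩

theorem apply_mem_cycleSet (σ : Equiv.Perm (Fin n)) (i : Fin n) : σ i ∈ cycleSet σ i :=
  (mem_cycleSet σ).2 ⟨1, by simp⟩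

/-- For an unmarked letter, `σ i` is its neighbour in the cycle word, and `isChain_treeParent` says
that comparing with this neighbour or with the parent gives the same answer. A marked maximum has
parent `0` and is no excedance, since a fixed one has color `0`; a marked minimum has parent `n + 1`
and is one, since a fixed one is also the maximum of its cycle and has non-zero color. -/
theorem mem_excedances_iff (i : Fin n) : i ∈ excedances π ↔ label i < parent π i := by
  simp only [excedances, Finset.mem_filter, Finset.mem_univ, true_and]
  by_cases hi : i = root π i
  · rw [parent_eq, if_pos hi]
    by_cases hz : IsZeroCycle π.1 (cycleSet π.2 i)
    · have hmm : markedMin π i = false := by simp [markedMin, hz]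
      have hr : i = (cycleSet π.2 i).max' (cycleSet_nonempty _ _) := by
        conv_lhs => rw [hi]
        simp [root, hz]
      have h0 := (isZeroCycle_cycleSet_iff π i).1 hz
      rw [← hr] at h0
      have hle : π.2 i ≤ i := by
        conv_rhs => rw [hr]
        exact Finset.le_max' _ _ (apply_mem_cycleSet _ _)
      simp [hmm, h0, hle]
    · have hmm : markedMin π i = true := by simp [markedMin, hz]
      have hr : i = (cycleSet π.2 i).min' (cycleSet_nonempty _ _) := by
        conv_lhs => rw [hi]
        simp [root, hz]
      have hle : i ≤ π.2 i := by
        conv_lhs => rw [hr]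
        exact Finset.min'_le _ _ (apply_mem_cycleSet _ _)
      simp only [hmm, if_true, label, Nat.add_lt_add_iff_right, Fin.is_lt, iff_true]
      refine hle.lt_or_eq.imp_right fun h => ⟨h.symm, ?_⟩
      intro h0
      refine hz ⟨i, self_mem_cycleSet _ _, fun j hj => ?_, h0⟩
      rw [mem_cycleSet] at hj
      exact (((Equiv.Perm.SameCycle.eq_of_left hj h.symm)).symm).le
  · have h1 : i ∈ (cycleWord π.2 (root π i)).reverse := by
      rw [mem_reverse_cycleWord, cycleSet_root]
      exact ⟨self_mem_cycleSet _ _, hi⟩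
    have hne : π.2 i ≠ i := fun h => by
      have := root_mem π i
      rw [mem_cycleSet] at this
      exact hi (this.eq_of_left h)
    have c1 := isChain_treeParent (markedMin π i) (root π i) (cycleWord π.2 (root π i)).reverse
      (List.nodup_cons.1 (nodup_cons_reverse_cycleWord _ _)).2 fun v hv => dirLT_root π hv
    have c2 := isChain_cons_reverse_cycleWord π.2 (root π i)
    rw [parent_eq, if_neg hi]
    obtain ⟨k, hk, hki⟩ := List.getElem_of_mem h1
    rw [List.isChain_iff_getElem] at c1 c2
    have c1' := c1 k (by simpa using hk)
    have c2' := c2 k (by simpa using hk)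
    simp only [List.getElem_cons_succ, hki] at c1' c2'
    rw [c2'] at c1'
    simp only [label, Nat.add_lt_add_iff_right, hne, false_and, or_false]
    exact c1'.symm

theorem parent_eq_zero_iff (i : Fin n) : parent π i = 0 ↔
    IsZeroCycle π.1 (cycleSet π.2 i) ∧ i = root π i := by
  rw [parent_eq]
  by_cases h : i = root π i <;> by_cases hz : IsZeroCycle π.1 (cycleSet π.2 i)
  · simp only [markedMin, hz, decide_true, ← h]; simp
  · simp only [markedMin, hz, ← h]; simp
  · simp [h, label]
  · simp [h, label]

theorem parent_eq_top_iff (i : Fin n) : parent π i = n + 1 ↔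
    ¬ IsZeroCycle π.1 (cycleSet π.2 i) ∧ i = root π i := by
  rw [parent_eq]
  by_cases h : i = root π i <;> by_cases hz : IsZeroCycle π.1 (cycleSet π.2 i)
  · simp only [markedMin, hz, decide_true, ← h]; simp
  · simp only [markedMin, hz, ← h]; simp
  · have := (innerParent π i i).is_lt
    simp [h, label]; omega
  · have := (innerParent π i i).is_lt
    simp [h, label]; omega

/-- Cycles are counted by any choice of a letter in each of them. -/
theorem card_filter_cycles (σ : Equiv.Perm (Fin n)) (P : Finset (Fin n) → Prop) [DecidablePred P]
    (f : Fin n → Fin n) (hf : ∀ i, f i ∈ cycleSet σ i)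
    (hf' : ∀ i j, cycleSet σ i = cycleSet σ j → f i = f j) :
    ((cycles σ).filter P).card =
      (Finset.univ.filter fun i => P (cycleSet σ i) ∧ i = f i).card := by
  symm
  refine Finset.card_bij (fun i _ => cycleSet σ i) ?_ ?_ ?_
  · intro i hi
    simp only [Finset.mem_filter, Finset.mem_univ, true_and] at hi
    simp [cycles, hi.1]
  · intro i hi j hj h
    simp only [Finset.mem_filter, Finset.mem_univ, true_and] at hi hj
    rw [hi.2, hj.2, hf' _ _ h]
  · intro c hc
    simp only [Finset.mem_filter, cycles, Finset.mem_image, Finset.mem_univ, true_and] at hc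
    obtain ⟨⟨i, rfl⟩, hP⟩ := hc
    have := cycleSet_eq_of_mem _ (hf i)
    refine ⟨f i, ?_, this⟩
    simp only [Finset.mem_filter, Finset.mem_univ, true_and, this]
    exact ⟨hP, (hf' _ _ this).symm⟩

theorem zc_eq_card_parent : zc π = (Finset.univ.filter fun i => parent π i = 0).card := by
  rw [zc, card_filter_cycles π.2 _ (root π) (root_mem π) fun i j => root_eq_of_cycleSet_eq π]
  simp only [parent_eq_zero_iff]

theorem nc_eq_card_parent : nc π = (Finset.univ.filter fun i => parent π i = n + 1).card := by
  rw [nc, card_filter_cycles π.2 _ (root π) (root_mem π) fun i j => root_eq_of_cycleSet_eq π]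
  simp only [parent_eq_top_iff]

/-- The maximum of the cycle of `i`. -/
def cycleMax (σ : Equiv.Perm (Fin n)) (i : Fin n) : Fin n :=
  (cycleSet σ i).max' (cycleSet_nonempty σ i)

theorem cycleMax_eq_of_cycleSet_eq (σ : Equiv.Perm (Fin n)) {i j : Fin n}
    (h : cycleSet σ i = cycleSet σ j) : cycleMax σ i = cycleMax σ j := by
  simp only [cycleMax, h]

/-- This second count, by colors instead of by parents, is the one needed for the size of the
fibres. -/
theorem zc_eq_card_cycleMax : zc π =
    (Finset.univ.filter fun i => π.1 i = 0 ∧ i = cycleMax π.2 i).card := by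
  rw [zc, card_filter_cycles π.2 _ (cycleMax π.2) (fun i => Finset.max'_mem _ _)
    fun i j => cycleMax_eq_of_cycleSet_eq _]
  congr 1
  refine Finset.filter_congr fun i _ => and_congr_left fun h => ?_
  rw [isZeroCycle_cycleSet_iff]
  conv_rhs => rw [h]
  rfl

theorem nc_eq_card_cycleMax : nc π =
    (Finset.univ.filter fun i => π.1 i ≠ 0 ∧ i = cycleMax π.2 i).card := by
  rw [nc, card_filter_cycles π.2 _ (cycleMax π.2) (fun i => Finset.max'_mem _ _)
    fun i j => cycleMax_eq_of_cycleSet_eq _]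
  congr 1
  refine Finset.filter_congr fun i _ => and_congr_left fun h => not_congr ?_
  rw [isZeroCycle_cycleSet_iff]
  conv_rhs => rw [h]
  rfl

theorem root_eq_of_parent_eq_label {i j : Fin n} (h : parent π i = label j) :
    root π j = root π i := by
  have hi : i ≠ root π i := fun hi => by
    rw [parent_eq, if_pos hi] at h
    simp only [label] at h
    split_ifs at h; all_goals omega
  have h' := innerParent_mem π hi
  rw [parent_eq, if_neg hi] at h
  rw [← label_injective h]
  exact root_eq_of_cycleSet_eq π (cycleSet_eq_of_mem _ h')

theorem eq_root_or_parent_eq_label (i : Fin n) :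
    i = root π i ∨ ∃ j : Fin n, parent π i = label j := by
  by_cases h : i = root π i
  · exact Or.inl h
  · exact Or.inr ⟨_, by rw [parent_eq, if_neg h]⟩

theorem parent_root (i : Fin n) : parent π (root π i) =
    if IsZeroCycle π.1 (cycleSet π.2 i) then 0 else n + 1 := by
  split_ifs with h
  · rw [parent_eq_zero_iff, cycleSet_root]
    exact ⟨h, (root_eq_of_cycleSet_eq π (cycleSet_root π i)).symm⟩
  · rw [parent_eq_top_iff, cycleSet_root]
    exact ⟨h, (root_eq_of_cycleSet_eq π (cycleSet_root π i)).symm⟩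

/-! ### What the tree remembers, and the size of its fibre -/

section Injective

variable {π} {π' : ColoredPerm r n}

/-- The marked letter is constant along edges inside `[n]`, so the letters where the two marked
letters differ are closed under taking parents, and there are none. -/
theorem root_eq_of_parent_eq (h : parent π = parent π') : root π = root π' := by
  have he : (Finset.univ.filter fun i => root π i ≠ root π' i) = ∅ := by
    refine (isAlternating_parent π).eq_empty_of_closed fun i hi => ?_
    simp only [Finset.mem_filter, Finset.mem_univ, true_and] at hi ⊢
    rcases eq_root_or_parent_eq_label π i with h1 | ⟨j, hj⟩
    · exfalso
      rcases eq_root_or_parent_eq_label π' i with h2 | ⟨j, hj⟩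
      · exact hi (h1.symm.trans h2)
      · rw [← h, parent_eq, if_pos h1] at hj
        simp only [label] at hj
        split_ifs at hj; all_goals omega
    · refine ⟨j, ?_, hj⟩
      rwa [root_eq_of_parent_eq_label π hj, root_eq_of_parent_eq_label π' (h ▸ hj)]
  funext i
  by_contra hi
  have : i ∈ (Finset.univ.filter fun i => root π i ≠ root π' i) := by simpa using hi
  simp [he] at this

theorem cycleSet_eq_of_parent_eq (h : parent π = parent π') (i : Fin n) : cycleSet π.2 i = cycleSet π'.2 i := by
  ext j
  have hr := root_eq_of_parent_eq h
  have key : ∀ ρ : ColoredPerm r n, j ∈ cycleSet ρ.2 i ↔ root ρ j = root ρ i := fun ρ => by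
    rw [root_eq_iff]
    exact ⟨cycleSet_eq_of_mem _, fun h' => h' ▸ self_mem_cycleSet _ _⟩
  rw [key, key, hr]

theorem isZeroCycle_iff_of_parent_eq (h : parent π = parent π') (i : Fin n) :
    IsZeroCycle π.1 (cycleSet π.2 i) ↔ IsZeroCycle π'.1 (cycleSet π'.2 i) := by
  have h1 := parent_root π i
  have h2 := parent_root π' i
  rw [← h, ← root_eq_of_parent_eq h, h1] at h2
  by_cases a : IsZeroCycle π.1 (cycleSet π.2 i) <;>
    by_cases b : IsZeroCycle π'.1 (cycleSet π'.2 i) <;> simp [a, b] at h2 ⊢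

/-- The tree gives the cycles, their marked letters and, by `treeParent_injective`, their words; the
words list the iterates of the inverse permutations. -/
theorem perm_eq_of_parent_eq (h : parent π = parent π') : π.2 = π'.2 := by
  have hr := root_eq_of_parent_eq h
  have hc := cycleSet_eq_of_parent_eq h
  have hm : ∀ i, markedMin π i = markedMin π' i := fun i => by
    simp only [markedMin, isZeroCycle_iff_of_parent_eq h i]
  have hw : ∀ i, (cycleWord π.2 (root π i)).reverse = (cycleWord π'.2 (root π' i)).reverse := by
    intro i
    refine treeParent_injective (markedMin π i) (root π i) _
      (List.nodup_cons.1 (nodup_cons_reverse_cycleWord _ _)).2 (fun v hv => dirLT_root π hv) _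
      (List.nodup_cons.1 (nodup_cons_reverse_cycleWord _ _)).2 ?_ fun v hv => ?_
    · ext v
      rw [List.mem_toFinset, List.mem_toFinset, mem_reverse_cycleWord, mem_reverse_cycleWord,
        hr, hc]
    · rw [mem_reverse_cycleWord, cycleSet_root] at hv
      have hv' : v ∈ cycleSet π'.2 i := hc i ▸ hv.1
      have e := root_eq_of_cycleSet_eq π (cycleSet_eq_of_mem _ hv.1)
      have e' := root_eq_of_cycleSet_eq π' (cycleSet_eq_of_mem _ hv')
      have p1 := parent_eq π v
      have p2 := parent_eq π' v
      rw [if_neg (by rw [e]; exact hv.2), innerParent_congr π hv.1] at p1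
      rw [if_neg (by rw [e', ← hr]; exact hv.2), innerParent_congr π' hv', ← h] at p2
      have := label_injective (p1.symm.trans p2)
      simpa only [innerParent, ← hm, ← hr] using this
  have hinv : π.2⁻¹ = π'.2⁻¹ := by
    ext1 v
    have hv : v ∈ cycleSet π.2⁻¹ (root π v) := by
      rw [cycleSet_inv, cycleSet_root]; exact self_mem_cycleSet _ _
    have e : List.iterate (π.2⁻¹ : Equiv.Perm _) (root π v) (cycleSet π.2 (root π v)).card =
        List.iterate (π'.2⁻¹ : Equiv.Perm _) (root π v) (cycleSet π.2 (root π v)).card := by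
      conv_rhs => rw [hc, hr]
      rw [← cons_reverse_cycleWord, ← cons_reverse_cycleWord, hw, hr]
    have e' : ∀ k ≤ (cycleSet π.2 (root π v)).card,
        (π.2⁻¹ : Equiv.Perm _)^[k] (root π v) = (π'.2⁻¹ : Equiv.Perm _)^[k] (root π v) := by
      intro k hk
      rcases hk.lt_or_eq with hk | rfl
      · have := congrArg (fun l => l[k]?) e
        simpa [List.getElem?_iterate, hk] using this
      -- The word omits the return to the marked letter, which is supplied here by the common cycle
      -- length.
      · have h1 := iterate_card_cycleSet π.2⁻¹ (root π v)
        have h2 := iterate_card_cycleSet π'.2⁻¹ (root π v)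
        rw [cycleSet_inv] at h1 h2
        rw [h1, hc, h2]
    rw [cycleSet_eq_image, Finset.mem_image] at hv
    obtain ⟨k, hk, hkv⟩ := hv
    rw [Finset.mem_range, ← card_cycleSet, cycleSet_inv] at hk
    have h3 := e' (k + 1) hk
    rwa [Function.iterate_succ_apply', Function.iterate_succ_apply', ← e' k hk.le, hkv] at h3
  exact inv_injective hinv

end Injective

end ColoredPerm

namespace ColoredPerm

theorem parent_eq_iff {r n : ℕ} {π π' : ColoredPerm r n} : parent π' = parent π ↔
    π'.2 = π.2 ∧ ∀ i, i = cycleMax π.2 i → (π'.1 i = 0 ↔ π.1 i = 0) := by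
  constructor
  · intro h
    have hp := perm_eq_of_parent_eq h
    refine ⟨hp, fun i hi => ?_⟩
    have := isZeroCycle_iff_of_parent_eq h i
    rw [isZeroCycle_cycleSet_iff, isZeroCycle_cycleSet_iff] at this
    change π'.1 (cycleMax π'.2 i) = 0 ↔ π.1 (cycleMax π.2 i) = 0 at this
    rwa [hp, ← hi] at this
  · rintro ⟨hp, h⟩
    have hz : ∀ i, IsZeroCycle π'.1 (cycleSet π.2 i) ↔ IsZeroCycle π.1 (cycleSet π.2 i) := by
      intro i
      rw [isZeroCycle_cycleSet_iff, ← hp, isZeroCycle_cycleSet_iff, hp]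
      exact h _ (cycleMax_eq_of_cycleSet_eq _ (cycleSet_eq_of_mem _ (Finset.max'_mem _ _)).symm)
    funext i
    simp only [parent, hp, hz]

/-- The number of colored permutations with a given tree. -/
theorem card_filter_parent_eq {r n : ℕ} [NeZero r] (π : ColoredPerm r n) :
    ((Finset.univ.filter fun π' : ColoredPerm r n => parent π' = parent π).card : ℝ) =
      r ^ n * (1 / r) ^ zc π * ((r - 1) / r) ^ nc π := by
  have hr : (r : ℝ) ≠ 0 := Nat.cast_ne_zero.2 (NeZero.ne r)
  -- Admissible colors at `i`: at a cycle maximum only `0`, or any of the `r - 1` non-zero colors,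
  -- according to the type of the cycle; elsewhere all `r` colors.
  let S : Fin n → Finset (ZMod r) := fun i =>
    if i = cycleMax π.2 i then (if π.1 i = 0 then {0} else Finset.univ.erase 0) else Finset.univ
  have hS : (Finset.univ.filter fun π' : ColoredPerm r n => parent π' = parent π).card =
      (Fintype.piFinset S).card := by
    symm
    refine Finset.card_bij (fun κ _ => (κ, π.2)) ?_ ?_ ?_
    · intro κ hκ
      rw [Fintype.mem_piFinset] at hκ
      simp only [Finset.mem_filter, Finset.mem_univ, true_and, parent_eq_iff]
      intro i hi
      have := hκ i
      simp only [S, if_pos hi] at this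
      split_ifs at this with h0 <;> simpa [h0] using this
    · intro κ _ κ' _ h
      exact (Prod.mk.inj h).1
    · rintro ⟨κ, σ⟩ h
      simp only [Finset.mem_filter, Finset.mem_univ, true_and, parent_eq_iff] at h
      obtain ⟨rfl, h⟩ := h
      refine ⟨κ, ?_, rfl⟩
      rw [Fintype.mem_piFinset]
      intro i
      simp only [S]
      split_ifs with h1 h2
      · simpa using (h i h1).2 h2
      · simpa using fun h3 => h2 ((h i h1).1 h3)
      · simp
  have hc : ∀ i, ((S i).card : ℝ) = r * (if π.1 i = 0 ∧ i = cycleMax π.2 i then 1 / (r : ℝ) else 1)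
      * (if π.1 i ≠ 0 ∧ i = cycleMax π.2 i then ((r : ℝ) - 1) / r else 1) := by
    intro i
    by_cases h1 : i = cycleMax π.2 i <;> by_cases h2 : π.1 i = 0
    · simp only [S, if_pos h1, if_pos h2, ← h1]; simp [h2, hr]
    · simp only [S, if_pos h1, if_neg h2, ← h1]
      rw [Finset.card_erase_of_mem (Finset.mem_univ _), Finset.card_univ, ZMod.card,
        Nat.cast_pred (Nat.pos_of_ne_zero (NeZero.ne r))]
      simp [h2]; field_simp
    · simp [S, h1, ZMod.card]
    · simp [S, h1, ZMod.card]
  rw [hS, Fintype.card_piFinset, Nat.cast_prod, Finset.prod_congr rfl fun i _ => hc i,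
    Finset.prod_mul_distrib, Finset.prod_mul_distrib, Finset.prod_ite, Finset.prod_ite,
    zc_eq_card_cycleMax, nc_eq_card_cycleMax]
  simp [div_pow]

end ColoredPerm

/-! ### From alternative trees back to colored permutations -/

namespace IsAlternating

open ColoredPerm

variable {n : ℕ} {p : Fin n → ℕ}

/-- The parent of `i` if it is in `[n]`, and `i` itself otherwise. -/
def step (p : Fin n → ℕ) (i : Fin n) : Fin n :=
  if h : 0 < p i ∧ p i ≤ n then ⟨p i - 1, by omega⟩ else i

theorem label_step {i : Fin n} (h : 0 < p i ∧ p i ≤ n) : label (step p i) = p i := by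
  simp only [step, dif_pos h, label]; omega

theorem step_eq_self {i : Fin n} (h : ¬ (0 < p i ∧ p i ≤ n)) : step p i = i := by
  rw [step, dif_neg h]

/-- The letter among the ancestors of `i` whose parent is `0` or `n + 1`. -/
def rootOf (p : Fin n → ℕ) (i : Fin n) : Fin n := (step p)^[n + 2] i

theorem rootOf_step (i : Fin n) : rootOf p (step p i) = step p (rootOf p i) := by
  simp only [rootOf, ← Function.iterate_succ_apply, ← Function.iterate_succ_apply']

/-- Edges get strictly longer on the way up, because a vertex lies strictly between its parent and
its grandparent. After `k` steps within `[n]` the next edge has length at least `k`, so `n + 2`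
steps are more than enough to stop. -/
theorem isRoot_rootOf (hp : IsAlternating p) (i : Fin n) :
    ¬ (0 < p (rootOf p i) ∧ p (rootOf p i) ≤ n) := by
  have key : ∀ k, (0 < p ((step p)^[k] i) ∧ p ((step p)^[k] i) ≤ n) →
      p ((step p)^[k] i) + k ≤ label ((step p)^[k] i) ∨
        label ((step p)^[k] i) + k ≤ p ((step p)^[k] i) := by
    intro k
    induction k with
    | zero => intro _; simp only [Function.iterate_zero, id]; omega
    | succ k ih =>
      rw [Function.iterate_succ_apply']
      generalize (step p)^[k] i = j at ih
      intro h
      by_cases hj : 0 < p j ∧ p j ≤ n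
      · have h1 := label_step hj
        have h2 := (hp j).2.2 _ h1.symm
        have h3 := ih hj
        unfold StrictlyBetween at h2
        omega
      · rw [step_eq_self hj] at h
        exact absurd h hj
  intro h
  have h1 := key (n + 2) h
  have := (hp (rootOf p i)).1
  have h2 : label (rootOf p i) ≤ n := by simp only [label]; omega
  unfold rootOf at this h2
  omega

theorem rootOf_step_eq (hp : IsAlternating p) (i : Fin n) :
    rootOf p (step p i) = rootOf p i := by
  rw [rootOf_step, step_eq_self (hp.isRoot_rootOf i)]

theorem rootOf_eq_self {i : Fin n} (h : ¬ (0 < p i ∧ p i ≤ n)) : rootOf p i = i :=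
  Function.iterate_fixed (step_eq_self h) _

/-- The children of `s` lie between `s` and `0` or `n + 1`, hence all on one side of `s`;
`dirLT_of_descendant` extends this to all descendants. -/
theorem isAltTree (hp : IsAlternating p) (s : Fin n) (hs : ¬ (0 < p s ∧ p s ≤ n)) :
    IsAltTree (decide (p s = n + 1)) s (Finset.univ.filter fun v => rootOf p v = s ∧ v ≠ s)
      (step p) := by
  have hv : ∀ v ∈ Finset.univ.filter fun v => rootOf p v = s ∧ v ≠ s, 0 < p v ∧ p v ≤ n := by
    intro v hv
    simp only [Finset.mem_filter, Finset.mem_univ, true_and] at hv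
    by_contra h
    exact hv.2 ((rootOf_eq_self h).symm.trans hv.1)
  have hstep : ∀ v ∈ Finset.univ.filter fun v => rootOf p v = s ∧ v ≠ s,
      step p v = s ∨ (step p v ∈ (Finset.univ.filter fun v => rootOf p v = s ∧ v ≠ s) ∧
        StrictlyBetween v (step p v) (step p (step p v))) := by
    intro v hm
    by_cases h : step p v = s
    · exact Or.inl h
    · have hm' : step p v ∈ Finset.univ.filter fun v => rootOf p v = s ∧ v ≠ s := by
        simp only [Finset.mem_filter, Finset.mem_univ, true_and] at hm ⊢
        exact ⟨(hp.rootOf_step_eq v).trans hm.1, h⟩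
      refine Or.inr ⟨hm', ?_⟩
      have h1 := (hp v).2.2 _ (label_step (hv v hm)).symm
      rw [← label_step (hv _ hm')] at h1
      simpa only [StrictlyBetween, label, Nat.add_lt_add_iff_right, Fin.val_fin_lt] using h1
  refine ⟨?_, hstep⟩
  have := dirLT_of_descendant (b := !decide (p s = n + 1)) (x := s) (p := step p)
    (B := Finset.univ.filter fun v => rootOf p v = s ∧ v ≠ s) fun v hm => by
    refine (hstep v hm).imp_left fun h => ⟨h, ?_⟩
    have h1 := (hp v).2.2 _ (label_step (hv v hm)).symm
    rw [h] at h1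
    have h2 := (hp s).1
    have h3 : label v ≤ n := by simp only [label]; omega
    by_cases h4 : p s = n + 1
    · simp only [StrictlyBetween, label, DirLT, h4, decide_true, Bool.not_true, Fin.lt_def] at *
      simp; omega
    · have h5 : p s = 0 := by omega
      simp only [StrictlyBetween, label, DirLT, h5, Fin.lt_def] at *
      simp; omega
  intro v hm
  exact dirLT_not.1 (this v hm)

/-- Each subtree below `0` or `n + 1` is the tree of a word by `IsAltTree.exists_word`, and the
words become the cycles. A non-zero color exists because `r ≥ 2`. -/
theorem exists_parent_eq {r : ℕ} (hr : 2 ≤ r) (hp : IsAlternating p) :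
    ∃ π : ColoredPerm r n, parent π = p := by
  have : Fact (1 < r) := ⟨hr⟩
  have hw : ∀ s, ∃ w : List (Fin n), ¬ (0 < p s ∧ p s ≤ n) → w.Nodup ∧
      w.toFinset = (Finset.univ.filter fun v => rootOf p v = s ∧ v ≠ s) ∧
      ∀ v ∈ (Finset.univ.filter fun v => rootOf p v = s ∧ v ≠ s),
        treeParent (decide (p s = n + 1)) s w v = step p v := fun s => by
    by_cases h : (0 < p s ∧ p s ≤ n)
    · exact ⟨[], fun h' => absurd h h'⟩
    · obtain ⟨w, hw⟩ := (hp.isAltTree s h).exists_word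
      exact ⟨w, fun _ => hw⟩
  choose W hW using hw
  have hmem : ∀ i v, v ∈ rootOf p i :: W (rootOf p i) ↔ rootOf p v = rootOf p i := by
    intro i v
    have hi := hp.isRoot_rootOf i
    rw [List.mem_cons, ← List.mem_toFinset, (hW _ hi).2.1]
    simp only [Finset.mem_filter, Finset.mem_univ, true_and]
    by_cases h : v = rootOf p i
    · rw [← h] at hi ⊢
      simpa using rootOf_eq_self hi
    · simp [h]
  have hnd : ∀ i, (rootOf p i :: W (rootOf p i)).Nodup := fun i => by
    have hi := hp.isRoot_rootOf i
    refine List.nodup_cons.2 ⟨?_, (hW _ hi).1⟩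
    rw [← List.mem_toFinset, (hW _ hi).2.1]
    simp
  have hR : ∀ i, rootOf p ((rootOf p i :: W (rootOf p i)).formPerm i) = rootOf p i := fun i =>
    (hmem i _).1 (List.formPerm_mem_iff_mem.2 ((hmem i i).2 rfl))
  have hR' : ∀ i, rootOf p ((rootOf p i :: W (rootOf p i)).formPerm⁻¹ i) = rootOf p i := fun i =>
    (hmem i _).1 (List.formPerm_mem_iff_mem.1 (by simpa using (hmem i i).2 rfl))
  -- All cycles at once: on each subtree `τ` steps through the word read from right to left. The
  -- permutation sought is therefore `τ⁻¹`.
  let τ : Equiv.Perm (Fin n) :=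
    { toFun := fun v => (rootOf p v :: W (rootOf p v)).formPerm v
      invFun := fun v => (rootOf p v :: W (rootOf p v)).formPerm⁻¹ v
      left_inv := fun v => by simp only [hR]; simp
      right_inv := fun v => by simp only [hR']; simp }
  have hτ : ∀ v, τ v = (rootOf p v :: W (rootOf p v)).formPerm v := fun v => rfl
  have hτR : ∀ k v, rootOf p (τ^[k] v) = rootOf p v := fun k => by
    induction k with
    | zero => simp
    | succ k ih => intro v; rw [Function.iterate_succ_apply', hτ, hR, ih]
  have hRR : ∀ i, rootOf p (rootOf p i) = rootOf p i := fun i =>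
    rootOf_eq_self (hp.isRoot_rootOf i)
  have hτk : ∀ i k, (hk : k < (rootOf p i :: W (rootOf p i)).length) →
      τ^[k] (rootOf p i) = (rootOf p i :: W (rootOf p i))[k] := by
    intro i k hk
    have h1 : τ^[k] (rootOf p i) = ((rootOf p i :: W (rootOf p i)).formPerm ^ k) (rootOf p i) := by
      clear hk
      induction k with
      | zero => simp
      | succ k ih =>
        rw [Function.iterate_succ_apply', hτ, hτR, hRR, ih, pow_succ']
        rfl
    have h2 := List.formPerm_pow_apply_getElem _ (hnd i) k 0 (by simp)
    simp only [zero_add, Nat.mod_eq_of_lt hk] at h2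
    rw [h1, ← h2]
    rfl
  have hcyc : ∀ i j, j ∈ cycleSet τ⁻¹ i ↔ rootOf p j = rootOf p i := by
    intro i j
    rw [cycleSet_inv, mem_cycleSet]
    constructor
    · intro h
      obtain ⟨k, -, -, hk⟩ := h.exists_pow_eq''
      rw [← hk, ← Equiv.Perm.iterate_eq_pow, hτR]
    · have key : ∀ v, τ.SameCycle (rootOf p v) v := fun v => by
        obtain ⟨k, hk, hkv⟩ := List.getElem_of_mem ((hmem v v).2 rfl)
        refine ⟨k, ?_⟩
        rw [zpow_natCast, ← Equiv.Perm.iterate_eq_pow, hτk v k hk, hkv]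
      intro h
      have := key j
      rw [h] at this
      exact (key i).symm.trans this
  let κ : Fin n → ZMod r := fun v => if p (rootOf p v) = 0 then 0 else 1
  let π : ColoredPerm r n := (κ, τ⁻¹)
  have hzero : ∀ i, IsZeroCycle π.1 (cycleSet π.2 i) ↔ p (rootOf p i) = 0 := fun i => by
    rw [isZeroCycle_cycleSet_iff]
    have := (hcyc i _).1 (Finset.max'_mem (cycleSet τ⁻¹ i) (cycleSet_nonempty _ _))
    simp only [π, κ, this]
    simp
  have hmark : ∀ i, markedMin π i = decide (p (rootOf p i) = n + 1) := fun i => by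
    have h1 := hp.isRoot_rootOf i
    have h2 := (hp (rootOf p i)).1
    simp only [markedMin, hzero]
    by_cases h : p (rootOf p i) = 0
    · simp [h]
    · have : p (rootOf p i) = n + 1 := by omega
      simp [this]
  have hroot : ∀ i, root π i = rootOf p i := fun i => by
    have h1 := hp.isRoot_rootOf i
    have h2 := (hp.isAltTree _ h1).lt
    have h3 : rootOf p i ∈ cycleSet π.2 i := (hcyc i _).2 (hRR i)
    have h4 := (hp (rootOf p i)).1
    have h5 : ∀ v ∈ cycleSet π.2 i, v = rootOf p i ∨
        DirLT (decide (p (rootOf p i) = n + 1)) (rootOf p i) v := fun v hv => by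
      by_cases h : v = rootOf p i
      · exact Or.inl h
      · exact Or.inr (h2 v (by simpa [h] using (hcyc i v).1 hv))
    unfold root
    simp only [hzero]
    by_cases h : p (rootOf p i) = 0
    · rw [if_pos h]
      refine le_antisymm (Finset.max'_le _ _ _ fun v hv => ?_) (Finset.le_max' _ _ h3)
      rcases h5 v hv with h6 | h6
      · exact h6.le
      · simp [h, DirLT] at h6; exact h6.le
    · rw [if_neg h]
      have h' : p (rootOf p i) = n + 1 := by omega
      refine le_antisymm (Finset.min'_le _ _ h3) (Finset.le_min' _ _ _ fun v hv => ?_)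
      rcases h5 v hv with h6 | h6
      · exact h6.ge
      · simp [h', DirLT] at h6; exact h6.le
  have hword : ∀ i, (cycleWord π.2 (rootOf p i)).reverse = W (rootOf p i) := fun i => by
    have hcard : (cycleSet π.2 (rootOf p i)).card = (rootOf p i :: W (rootOf p i)).length := by
      rw [← List.toFinset_card_of_nodup (hnd i)]
      congr 1
      ext v
      rw [List.mem_toFinset, hmem, hcyc, hRR]
    have := cons_reverse_cycleWord π.2 (rootOf p i)
    refine List.cons_injective (a := rootOf p i) (this.trans ?_)
    apply List.ext_getElem
    · rw [List.length_iterate, hcard]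
    · intro k h1 h2
      rw [List.getElem_iterate, ← hτk i k h2]
      simp [π]
  refine ⟨π, funext fun i => ?_⟩
  rw [parent_eq, innerParent, hroot, hmark, hword]
  have h1 := hp.isRoot_rootOf i
  have h2 := (hp (rootOf p i)).1
  by_cases h : i = rootOf p i
  · rw [if_pos h]
    conv_rhs => rw [h]
    split_ifs with h3
    · exact (of_decide_eq_true h3).symm
    · have := of_decide_eq_false (Bool.eq_false_iff.2 h3)
      omega
  · rw [if_neg h, (hW _ h1).2.2 i (by simpa using h), label_step]
    by_contra h3
    exact h (rootOf_eq_self h3).symm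

end IsAlternating

open ColoredPerm

/-! ### Weighted trees and the relations of the matrix ansatz -/

section TreeWeights

variable {n : ℕ}

instance (p : Fin n → ℕ) : Decidable (IsAlternating p) := by
  unfold IsAlternating StrictlyBetween; infer_instance

/-- The parent functions of alternative trees on `{0, …, n + 1}`. -/
def alternatingTrees (n : ℕ) : Finset (Fin n → ℕ) :=
  (Fintype.piFinset fun _ => Finset.range (n + 2)).filter IsAlternating

theorem mem_alternatingTrees {p : Fin n → ℕ} : p ∈ alternatingTrees n ↔ IsAlternating p := by
  rw [alternatingTrees, Finset.mem_filter, Fintype.mem_piFinset]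
  exact ⟨And.right, fun h => ⟨fun i => Finset.mem_range.2 (Nat.lt_succ_of_le (h i).1), h⟩⟩

/-- The configuration whose particles are the vertices that are smaller than their parents. -/
def ascents (p : Fin n → ℕ) : Config n := fun i => decide (label i < p i)

/-- The number of pairs `i < j` with `p j < i < j < p i`. -/
def yinYang (p : Fin n → ℕ) : ℕ :=
  (Finset.univ.filter fun ij : Fin n × Fin n =>
    ij.1 < ij.2 ∧ p ij.2 < label ij.1 ∧ label ij.2 < p ij.1).card

/-- The weight `a ^ #{i | p i = 0} * b ^ #{i | p i = n + 1} * q ^ yinYang p`. -/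
noncomputable def treeWeight (a b q : ℝ) (p : Fin n → ℕ) : ℝ :=
  (∏ i, (if p i = 0 then a else 1) * (if p i = n + 1 then b else 1)) * q ^ yinYang p

/-- The total weight of the trees with given ascents. -/
noncomputable def configWeight (a b q : ℝ) (η : Config n) : ℝ :=
  ∑ p ∈ (alternatingTrees n).filter fun p => ascents p = η, treeWeight a b q p

/-- The order embedding `ℕ → ℕ` that misses `k + 1`. -/
def shift (k x : ℕ) : ℕ := if x ≤ k then x else x + 1

theorem label_succAbove (k : Fin (n + 1)) (j : Fin n) :
    label (k.succAbove j) = shift k (label j) := by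
  simp only [label, shift, Fin.succAbove, Fin.lt_def, Fin.val_castSucc]
  split_ifs <;> simp <;> omega

/-- Add the vertex `k` with parent `c`. -/
def insertVertex (k : Fin (n + 1)) (c : ℕ) (p : Fin n → ℕ) : Fin (n + 1) → ℕ :=
  Fin.insertNth (α := fun _ => ℕ) k c fun j => shift k (p j)

theorem insertVertex_same (k : Fin (n + 1)) (c : ℕ) (p : Fin n → ℕ) :
    insertVertex k c p k = c := Fin.insertNth_apply_same _ _ _

theorem insertVertex_succAbove (k : Fin (n + 1)) (c : ℕ) (p : Fin n → ℕ) (j : Fin n) :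
    insertVertex k c p (k.succAbove j) = shift k (p j) := Fin.insertNth_apply_succAbove _ _ _ _

theorem shift_lt_shift {k x y : ℕ} : shift k x < shift k y ↔ x < y := by
  unfold shift; split_ifs <;> omega

theorem shift_injective (k : ℕ) : Function.Injective (shift k) := fun x y h => by
  have h1 := shift_lt_shift (k := k) (x := x) (y := y)
  have h2 := shift_lt_shift (k := k) (x := y) (y := x)
  omega

theorem shift_ne (k x : ℕ) : shift k x ≠ k + 1 := by
  unfold shift; split_ifs <;> omega

/-- The new vertex has label `k + 1`, and `c` is a neighbouring label. Nothing hangs from the new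
vertex, so the only new condition concerns the vertex itself. -/
theorem isAlternating_insertVertex_iff {k : Fin (n + 1)} {c : ℕ} (hc : c = k ∨ c = k + 2)
    {p : Fin n → ℕ} : IsAlternating (insertVertex k c p) ↔ IsAlternating p ∧
      ∀ j, c = label (k.succAbove j) → StrictlyBetween (label k) c (shift k (p j)) := by
  have hk := k.is_lt
  unfold IsAlternating
  rw [Fin.forall_iff_succAbove k, and_comm]
  simp only [Fin.forall_iff_succAbove k, insertVertex_same, insertVertex_succAbove]
  have hlk : label k = k + 1 := rfl
  refine and_congr (forall_congr' fun i => ?_) ?_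
  · refine and_congr ?_ (and_congr ?_ ?_)
    · unfold shift; split_ifs <;> omega
    · rw [label_succAbove, (shift_injective k).ne_iff]
    · simp only [hlk, shift_ne, false_imp_iff, true_and, label_succAbove,
        (shift_injective k).eq_iff, StrictlyBetween, shift_lt_shift]
  · constructor
    · rintro ⟨-, -, -, h⟩ j hj
      rw [hj]; exact h j hj
    · intro h
      refine ⟨by omega, by omega, fun h' => by omega, fun j hj => ?_⟩
      rw [← hj]; exact h j hj

/-- A child of the vertex `k + 1` would have to lie strictly between two consecutive labels, so this
vertex is a leaf and can be deleted. -/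
theorem exists_insertVertex_eq {p : Fin (n + 1) → ℕ} (hp : IsAlternating p) {k : Fin (n + 1)}
    (hk : p k = k ∨ p k = k + 2) : ∃ p', insertVertex k (p k) p' = p := by
  refine ⟨fun j => if p (k.succAbove j) ≤ k then p (k.succAbove j) else p (k.succAbove j) - 1,
    funext fun i => ?_⟩
  rcases Fin.eq_self_or_eq_succAbove k i with rfl | ⟨j, rfl⟩
  · rw [insertVertex_same]
  · rw [insertVertex_succAbove]
    have h1 := (hp (k.succAbove j)).2.2 k
    have h2 : label (k.succAbove j) ≠ label k :=
      fun h => Fin.succAbove_ne k j (label_injective h)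
    simp only [StrictlyBetween] at h1
    have hlk : label k = k + 1 := rfl
    rw [hlk] at h1 h2
    unfold shift
    split_ifs <;> omega

/-- In a yin-yang pair each member's edge passes over the other member, and an edge between
consecutive labels passes over nothing. -/
theorem yinYang_insertVertex {k : Fin (n + 1)} {c : ℕ} (hc : c = k ∨ c = k + 2)
    (p : Fin n → ℕ) : yinYang (insertVertex k c p) = yinYang p := by
  symm
  refine Finset.card_bij (fun ij _ => (k.succAbove ij.1, k.succAbove ij.2)) ?_ ?_ ?_
  · rintro ⟨i, j⟩ h
    simpa only [Finset.mem_filter, Finset.mem_univ, true_and, insertVertex_succAbove,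
      label_succAbove, shift_lt_shift, Fin.succAbove_lt_succAbove_iff] using h
  · rintro ⟨i, j⟩ - ⟨i', j'⟩ - h
    simpa using h
  · rintro ⟨i, j⟩ h
    simp only [Finset.mem_filter, Finset.mem_univ, true_and] at h
    rcases Fin.eq_self_or_eq_succAbove k i with rfl | ⟨i, rfl⟩
    · rw [insertVertex_same, Fin.lt_def] at h
      simp only [label] at h
      omega
    rcases Fin.eq_self_or_eq_succAbove k j with rfl | ⟨j, rfl⟩
    · rw [insertVertex_same, Fin.lt_def] at h
      simp only [label] at h
      omega
    refine ⟨(i, j), ?_, rfl⟩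
    simpa only [Finset.mem_filter, Finset.mem_univ, true_and, insertVertex_succAbove,
      label_succAbove, shift_lt_shift, Fin.succAbove_lt_succAbove_iff] using h

theorem treeWeight_insertVertex (a b q : ℝ) {k : Fin (n + 1)} {c : ℕ} (hc : c = k ∨ c = k + 2)
    (p : Fin n → ℕ) : treeWeight a b q (insertVertex k c p) =
      (if c = 0 then a else 1) * (if c = n + 2 then b else 1) * treeWeight a b q p := by
  have hk := k.is_lt
  have h0 : ∀ x, shift k x = 0 ↔ x = 0 := fun x => by grind [shift]
  have h1 : ∀ x, shift k x = n + 2 ↔ x = n + 1 := fun x => by grind [shift]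
  simp only [treeWeight, yinYang_insertVertex hc, Fin.prod_univ_succAbove _ k, insertVertex_same,
    insertVertex_succAbove, h0, h1, add_assoc, one_add_one_eq_two]
  ring

/-- The trees in which `k` is a leaf adjacent to its parent. -/
theorem sum_treeWeight_leaf (a b q : ℝ) (η : Config (n + 1)) {k : Fin (n + 1)} {c : ℕ}
    (hc : c = k ∨ c = k + 2) (hη : η k = decide (label k < c))
    (hη' : ∀ j, c = label (k.succAbove j) → η (k.succAbove j) = !η k) :
    ∑ p ∈ ((alternatingTrees (n + 1)).filter fun p => ascents p = η).filter (fun p => p k = c),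
      treeWeight a b q p = (if c = 0 then a else 1) * (if c = n + 2 then b else 1) *
        configWeight a b q (k.removeNth η) := by
  have hasc : ∀ p : Fin n → ℕ, ascents (insertVertex k c p) = η ↔ ascents p = k.removeNth η := by
    intro p
    rw [funext_iff, funext_iff, Fin.forall_iff_succAbove k]
    simp only [ascents, insertVertex_same, insertVertex_succAbove, label_succAbove,
      shift_lt_shift, hη, true_and, Fin.removeNth]
  rw [configWeight, Finset.mul_sum]
  symm
  refine Finset.sum_bij (fun p _ => insertVertex k c p) ?_ ?_ ?_ ?_
  · intro p hp
    simp only [Finset.mem_filter, mem_alternatingTrees, isAlternating_insertVertex_iff hc,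
      hasc, insertVertex_same, and_true] at hp ⊢
    -- By `hη'` the parent `c` goes up exactly when the leaf goes down. So the edge above `c` points
    -- back over the leaf, which is the alternation condition.
    refine ⟨⟨hp.1, fun j hj => ?_⟩, hp.2⟩
    have h1 := hη' j hj
    have h2 := congrFun hp.2 j
    simp only [Fin.removeNth, ascents] at h2
    rw [← h2, hη] at h1
    have h3 := (hp.1 j).2.1
    rw [label_succAbove] at hj
    have h4 := shift_ne k (p j)
    have h5 := (shift_injective k).ne h3
    rw [← hj] at h5
    have h6 : c < shift k (p j) ↔ label j < p j := by rw [hj, shift_lt_shift]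
    have hlk : label k = k + 1 := rfl
    unfold StrictlyBetween
    by_cases h7 : label j < p j <;> by_cases h8 : label k < c <;> simp [h7, h8] at h1 h6 <;> omega
  · intro p _ p' _ h
    funext j
    have := congrFun h (k.succAbove j)
    simp only [insertVertex_succAbove] at this
    exact shift_injective k this
  · intro p hp
    simp only [Finset.mem_filter, mem_alternatingTrees] at hp
    obtain ⟨p', hp'⟩ := exists_insertVertex_eq hp.1.1 (k := k) (by rw [hp.2]; exact hc)
    rw [hp.2] at hp'
    refine ⟨p', ?_, hp'⟩
    rw [← hp', isAlternating_insertVertex_iff hc, hasc] at hp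
    simp only [Finset.mem_filter, mem_alternatingTrees]
    exact ⟨hp.1.1.1, hp.1.2⟩
  · intro p _
    rw [treeWeight_insertVertex a b q hc]

theorem configWeight_of_first_vacant (a b q : ℝ) (η : Config (n + 1)) (h : η 0 = false) :
    configWeight a b q η = a * configWeight a b q (Fin.removeNth 0 η) := by
  have := sum_treeWeight_leaf a b q η (k := 0) (c := 0) (Or.inl rfl) (by simp [h])
    (fun j hj => by simp [label] at hj)
  rw [Finset.filter_true_of_mem] at this
  · rw [configWeight, this]; simp
  · intro p hp
    simp only [Finset.mem_filter, mem_alternatingTrees] at hp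
    have h1 := congrFun hp.2 0
    have h2 := (hp.1 0).2.1
    simp only [ascents, h, decide_eq_false_iff_not] at h1
    simp only [label, Fin.val_zero] at h1 h2
    omega

theorem configWeight_of_last_occupied (a b q : ℝ) (η : Config (n + 1))
    (h : η (Fin.last n) = true) :
    configWeight a b q η = b * configWeight a b q (Fin.removeNth (Fin.last n) η) := by
  have := sum_treeWeight_leaf a b q η (k := Fin.last n) (c := n + 2) (Or.inr rfl)
    (by simp [h, label])
    (fun j hj => by have := j.is_lt; simp [label] at hj; omega)
  rw [Finset.filter_true_of_mem] at this
  · rw [configWeight, this]; simp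
  · intro p hp
    simp only [Finset.mem_filter, mem_alternatingTrees] at hp
    have h1 := congrFun hp.2 (Fin.last n)
    have h2 := (hp.1 (Fin.last n)).1
    simp only [ascents, h, decide_eq_true_eq] at h1
    simp only [label, Fin.val_last] at h1 h2
    omega

/-! ### Exchanging adjacent vertices -/

/-- The transposition of `k + 1` and `k + 2`. -/
def adjSwap (k x : ℕ) : ℕ := if x = k + 1 then k + 2 else if x = k + 2 then k + 1 else x

theorem adjSwap_adjSwap (k x : ℕ) : adjSwap k (adjSwap k x) = x := by
  unfold adjSwap; split_ifs <;> omega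

theorem adjSwap_eq_iff {k x y : ℕ} : adjSwap k x = y ↔ x = adjSwap k y :=
  ⟨fun h => by rw [← h, adjSwap_adjSwap], fun h => by rw [h, adjSwap_adjSwap]⟩

theorem label_swap (k : Fin n) (i : Fin (n + 1)) :
    label (Equiv.swap k.castSucc k.succ i) = adjSwap k (label i) := by
  unfold adjSwap
  by_cases h1 : i = k.castSucc
  · subst h1; simp [label]
  by_cases h2 : i = k.succ
  · subst h2; simp [label]
  rw [Equiv.swap_apply_of_ne_of_ne h1 h2]
  simp only [Fin.ext_iff, Fin.val_castSucc, Fin.val_succ] at h1 h2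
  have hl : label i = i + 1 := rfl
  split_ifs <;> omega

/-- Exchange the vertices `k + 1` and `k + 2`. -/
def swapVertices (k : Fin n) (p : Fin (n + 1) → ℕ) (i : Fin (n + 1)) : ℕ :=
  adjSwap k (p (Equiv.swap k.castSucc k.succ i))

theorem swapVertices_swap (k : Fin n) (p : Fin (n + 1) → ℕ) (i : Fin (n + 1)) :
    swapVertices k p (Equiv.swap k.castSucc k.succ i) = adjSwap k (p i) := by
  rw [swapVertices, Equiv.swap_apply_self]

theorem swapVertices_swapVertices (k : Fin n) (p : Fin (n + 1) → ℕ) :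
    swapVertices k (swapVertices k p) = p := by
  funext i
  rw [swapVertices, swapVertices_swap, adjSwap_adjSwap]

theorem swapVertices_castSucc (k : Fin n) (p : Fin (n + 1) → ℕ) :
    swapVertices k p k.castSucc = adjSwap k (p k.succ) := by
  rw [swapVertices, Equiv.swap_apply_left]

theorem swapVertices_succ (k : Fin n) (p : Fin (n + 1) → ℕ) :
    swapVertices k p k.succ = adjSwap k (p k.castSucc) := by
  rw [swapVertices, Equiv.swap_apply_right]

theorem eq_castSucc_of_label_eq {k : Fin n} {i : Fin (n + 1)} (h : label i = k + 1) :
    i = k.castSucc := by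
  simp only [label] at h; ext; simp; omega

theorem eq_succ_of_label_eq {k : Fin n} {i : Fin (n + 1)} (h : label i = k + 2) :
    i = k.succ := by
  simp only [label] at h; ext; simp; omega

/-- The vertices `k + 1` and `k + 2` are separated from each other by their edges. -/
def Crossed (k : Fin n) (p : Fin (n + 1) → ℕ) : Prop :=
  k + 2 < p k.castSucc ∧ p k.succ < k + 1 ∨ p k.castSucc < k + 1 ∧ k + 2 < p k.succ

theorem adjSwap_lt_adjSwap {k x y : ℕ} (h : ¬ (x = k + 1 ∧ y = k + 2))
    (h' : ¬ (x = k + 2 ∧ y = k + 1)) : adjSwap k x < adjSwap k y ↔ x < y := by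
  unfold adjSwap; split_ifs <;> omega

/-- The exchange reverses only the comparison of `k + 1` with `k + 2`. When the edges of these two
vertices leave in opposite directions past each other, no alternation condition compares them. -/
theorem IsAlternating.swapVertices {k : Fin n} {p : Fin (n + 1) → ℕ} (hp : IsAlternating p)
    (hk : Crossed k p) : IsAlternating (swapVertices k p) := by
  intro i
  have hkn := k.is_lt
  obtain ⟨i, rfl⟩ := (Equiv.swap k.castSucc k.succ).surjective i
  rw [swapVertices_swap, label_swap]
  refine ⟨?_, ?_, fun j => ?_⟩
  · have := (hp i).1
    unfold adjSwap; split_ifs <;> omega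
  · intro h
    rw [adjSwap_eq_iff, adjSwap_adjSwap] at h
    exact (hp i).2.1 h
  · obtain ⟨j, rfl⟩ := (Equiv.swap k.castSucc k.succ).surjective j
    rw [swapVertices_swap, label_swap]
    intro h
    rw [adjSwap_eq_iff, adjSwap_adjSwap] at h
    have h1 := (hp i).2.2 j h
    have h2 := (hp j).2.2 k.castSucc
    have h3 := (hp j).2.2 k.succ
    have i1 : label i = k + 1 → p i = p k.castSucc := fun h => by rw [eq_castSucc_of_label_eq h]
    have i2 : label i = k + 2 → p i = p k.succ := fun h => by rw [eq_succ_of_label_eq h]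
    have l1 : label k.castSucc = k + 1 := rfl
    have l2 : label k.succ = k + 2 := rfl
    unfold Crossed at hk
    rw [l1] at h2
    rw [l2] at h3
    simp only [StrictlyBetween] at h1 h2 h3 ⊢
    rw [adjSwap_lt_adjSwap, adjSwap_lt_adjSwap, adjSwap_lt_adjSwap, adjSwap_lt_adjSwap]
    · exact h1
    all_goals omega

theorem ascents_swapVertices {k : Fin n} {p : Fin (n + 1) → ℕ} (hk : Crossed k p) :
    ascents (swapVertices k p) = ascents p ∘ Equiv.swap k.castSucc k.succ := by
  funext i
  obtain ⟨i, rfl⟩ := (Equiv.swap k.castSucc k.succ).surjective i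
  rw [Function.comp_apply, Equiv.swap_apply_self, ascents, ascents, swapVertices_swap, label_swap,
    decide_eq_decide]
  unfold Crossed at hk
  have i1 : label i = k + 1 → p i = p k.castSucc := fun h => by rw [eq_castSucc_of_label_eq h]
  have i2 : label i = k + 2 → p i = p k.succ := fun h => by rw [eq_succ_of_label_eq h]
  apply adjSwap_lt_adjSwap <;> omega

/-- The pair `k + 1`, `k + 2` itself is the yin-yang pair that is lost; the others are carried over
by the exchange. -/
theorem yinYang_eq_swapVertices {k : Fin n} {p : Fin (n + 1) → ℕ} (hp : IsAlternating p)
    (h1 : k + 2 < p k.castSucc) (h2 : p k.succ < k + 1) :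
    yinYang p = yinYang (swapVertices k p) + 1 := by
  have hmem : (k.castSucc, k.succ) ∈ Finset.univ.filter fun ij : Fin (n + 1) × Fin (n + 1) =>
      ij.1 < ij.2 ∧ p ij.2 < label ij.1 ∧ label ij.2 < p ij.1 := by
    simp only [Finset.mem_filter, Finset.mem_univ, true_and]
    exact ⟨Fin.castSucc_lt_succ, h2, h1⟩
  rw [yinYang, ← Finset.card_erase_add_one hmem, Nat.add_right_cancel_iff]
  refine Finset.card_equiv
    ((Equiv.swap k.castSucc k.succ).prodCongr (Equiv.swap k.castSucc k.succ)) ?_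
  rintro ⟨i, j⟩
  have hlab : ∀ i j : Fin (n + 1), i < j ↔ label i < label j := fun i j => by
    simp [label]
  simp only [Finset.mem_erase, Finset.mem_filter, Finset.mem_univ, true_and,
    Equiv.prodCongr_apply, Prod.map_apply, hlab, swapVertices_swap, label_swap]
  have hne : (i, j) ≠ (k.castSucc, k.succ) ↔ ¬ (label i = k + 1 ∧ label j = k + 2) := by
    rw [ne_eq, Prod.mk_inj]
    refine not_congr (and_congr ⟨?_, eq_castSucc_of_label_eq⟩ ⟨?_, eq_succ_of_label_eq⟩)
    · rintro rfl; rfl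
    · rintro rfl; rfl
  rw [hne]
  have i1 : label i = k + 1 → p i = p k.castSucc := fun h => by rw [eq_castSucc_of_label_eq h]
  have i2 : label i = k + 2 → p i = p k.succ := fun h => by rw [eq_succ_of_label_eq h]
  have j1 : label j = k + 1 → p j = p k.castSucc := fun h => by rw [eq_castSucc_of_label_eq h]
  have j2 : label j = k + 2 → p j = p k.succ := fun h => by rw [eq_succ_of_label_eq h]
  have i3 : p i = k + 1 → _ := (hp i).2.2 k.castSucc
  have i4 : p i = k + 2 → _ := (hp i).2.2 k.succ
  have j3 : p j = k + 1 → _ := (hp j).2.2 k.castSucc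
  have j4 : p j = k + 2 → _ := (hp j).2.2 k.succ
  have l1 : label k.castSucc = k + 1 := rfl
  have l2 : label k.succ = k + 2 := rfl
  simp only [StrictlyBetween, l1, l2] at i3 i4 j3 j4
  generalize label i = x at *
  generalize label j = y at *
  generalize p i = u at *
  generalize p j = v at *
  clear hne hmem hlab
  constructor
  · rintro ⟨a1, a2, a3, a4⟩
    refine ⟨?_, ?_, ?_⟩ <;> rw [adjSwap_lt_adjSwap] <;> omega
  · rintro ⟨a2, a3, a4⟩
    unfold adjSwap at a2 a3 a4
    split_ifs at a2 a3 a4 <;> omega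

theorem treeWeight_eq_swapVertices (a b q : ℝ) {k : Fin n} {p : Fin (n + 1) → ℕ}
    (hp : IsAlternating p) (h1 : k + 2 < p k.castSucc) (h2 : p k.succ < k + 1) :
    treeWeight a b q p = q * treeWeight a b q (swapVertices k p) := by
  have hk := k.is_lt
  have h3 : ∀ x, adjSwap k x = 0 ↔ x = 0 := fun x => by grind [adjSwap]
  have h4 : ∀ x, adjSwap k x = n + 1 + 1 ↔ x = n + 1 + 1 := fun x => by grind [adjSwap]
  simp only [treeWeight, yinYang_eq_swapVertices hp h1 h2, swapVertices, h3, h4]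
  rw [Equiv.prod_comp (Equiv.swap k.castSucc k.succ) fun i =>
    (if p i = 0 then a else 1) * (if p i = n + 1 + 1 then b else 1), pow_succ]
  ring

/-- Three disjoint classes of trees: `k + 1` hangs from `k + 2`, or `k + 2` from `k + 1`, or
neither. The first two lose a leaf of weight `1`; the third is exchanged at the price of `q`. -/
theorem configWeight_of_occupied_vacant (a b q : ℝ) (η : Config (n + 1)) (k : Fin n)
    (h1 : η k.castSucc = true) (h2 : η k.succ = false) :
    configWeight a b q η = q * configWeight a b q (η ∘ Equiv.swap k.castSucc k.succ) +
      configWeight a b q (k.castSucc.removeNth η) + configWeight a b q (k.succ.removeNth η) := by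
  have hkn := k.is_lt
  have hasc : ∀ p : Fin (n + 1) → ℕ, IsAlternating p → ascents p = η →
      k + 1 < p k.castSucc ∧ p k.succ < k + 2 := by
    rintro p hp rfl
    have h3 := (hp k.succ).2.1
    simp only [ascents, decide_eq_true_eq, decide_eq_false_iff_not] at h1 h2
    simp only [label, Fin.val_castSucc, Fin.val_succ] at h1 h2 h3
    omega
  have A := sum_treeWeight_leaf a b q η (k := k.castSucc) (c := k + 2) (Or.inr rfl)
    (by simp [h1, label]) (fun j hj => by rw [h1, ← eq_succ_of_label_eq hj.symm] at *; simpa using h2)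
  have B := sum_treeWeight_leaf a b q η (k := k.succ) (c := k + 1) (Or.inl (by simp))
    (by simp [h2, label]) (fun j hj => by
      rw [h2]; rw [eq_castSucc_of_label_eq hj.symm]; simpa using h1)
  rw [if_neg (by omega), if_neg (by omega), one_mul, one_mul] at A B
  have C : ∑ p ∈ (((alternatingTrees (n + 1)).filter fun p => ascents p = η).filter
      (fun p => ¬ p k.castSucc = (k : ℕ) + 2)).filter (fun p => ¬ p k.succ = (k : ℕ) + 1),
      treeWeight a b q p = q * configWeight a b q (η ∘ Equiv.swap k.castSucc k.succ) := by
    rw [configWeight, Finset.mul_sum]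
    refine Finset.sum_nbij' (swapVertices k) (swapVertices k) ?_ ?_
      (fun p _ => swapVertices_swapVertices k p) (fun p _ => swapVertices_swapVertices k p) ?_
    · intro p hp
      simp only [Finset.mem_filter, mem_alternatingTrees] at hp ⊢
      have h3 := hasc p hp.1.1.1 hp.1.1.2
      have hc : Crossed k p := Or.inl (by omega)
      exact ⟨hp.1.1.1.swapVertices hc, by rw [ascents_swapVertices hc, hp.1.1.2]⟩
    · intro p hp
      simp only [Finset.mem_filter, mem_alternatingTrees] at hp ⊢
      have e1 := congrFun hp.2 k.castSucc
      have e2 := congrFun hp.2 k.succ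
      have e3 := (hp.1 k.castSucc).2
      have e4 := hp.1 k.succ
      simp only [Function.comp_apply, Equiv.swap_apply_left, Equiv.swap_apply_right, h1, h2,
        ascents, decide_eq_true_eq, decide_eq_false_iff_not] at e1 e2
      simp only [label, Fin.val_castSucc, Fin.val_succ] at e1 e2 e3 e4
      -- With `k + 1` vacant and `k + 2` occupied the edges are always crossed, so the exchange
      -- reaches every tree over the swapped configuration.
      have hc : Crossed k p := Or.inr (by omega)
      refine ⟨⟨⟨hp.1.swapVertices hc, ?_⟩, ?_⟩, ?_⟩
      · rw [ascents_swapVertices hc, hp.2]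
        funext i; simp
      · rw [swapVertices_castSucc, adjSwap_eq_iff]
        unfold adjSwap; split_ifs <;> omega
      · rw [swapVertices_succ, adjSwap_eq_iff]
        unfold adjSwap; split_ifs <;> omega
    · intro p hp
      simp only [Finset.mem_filter, mem_alternatingTrees] at hp
      have h3 := hasc p hp.1.1.1 hp.1.1.2
      exact treeWeight_eq_swapVertices a b q hp.1.1.1 (by omega) (by omega)
  have B' : (((alternatingTrees (n + 1)).filter fun p => ascents p = η).filter
      (fun p => ¬ p k.castSucc = (k : ℕ) + 2)).filter (fun p => p k.succ = (k : ℕ) + 1) =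
      ((alternatingTrees (n + 1)).filter fun p => ascents p = η).filter
        (fun p => p k.succ = (k : ℕ) + 1) := by
    ext p
    simp only [Finset.mem_filter, mem_alternatingTrees]
    constructor
    · rintro ⟨⟨h3, -⟩, h4⟩; exact ⟨h3, h4⟩
    · rintro ⟨h3, h4⟩
      refine ⟨⟨h3, fun h5 => ?_⟩, h4⟩
      have := (h3.1 k.castSucc).2.2 k.succ h5
      simp only [StrictlyBetween, label, Fin.val_castSucc, Fin.val_succ] at this
      omega
  rw [configWeight, ← Finset.sum_filter_add_sum_filter_not _ (fun p => p k.castSucc = (k : ℕ) + 2), A,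
    ← Finset.sum_filter_add_sum_filter_not
      (Finset.filter (fun p : Fin (n + 1) → ℕ => ¬ p k.castSucc = (k : ℕ) + 2) _)
      (fun p => p k.succ = (k : ℕ) + 1), C, B', B]
  ring

end TreeWeights

/-! ### From the matrix ansatz relations to stationarity -/

section Stationarity

variable {n : ℕ}

theorem eq_comp_swap_iff {η ξ : Config n} {i j : Fin n} :
    η = ξ ∘ Equiv.swap i j ↔ ξ = η ∘ Equiv.swap i j := by
  constructor <;> rintro rfl <;> funext k <;> simp

/-- Each kind of move into `η` at given sites has a single possible origin, obtained by undoing the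
move. -/
theorem sum_mul_exclusionRate (Q : Fin n → Fin n → ℝ) (b d : Fin n → ℝ) (f : Config n → ℝ)
    (η : Config n) : ∑ ξ, f ξ * exclusionRate Q b d ξ η =
      (∑ i, ∑ j, Q i j * if η j = true ∧ η i = false then f (η ∘ Equiv.swap i j) else 0)
      + (∑ i, b i * if η i = true then f (Function.update η i false) else 0)
      + (∑ i, d i * if η i = false then f (Function.update η i true) else 0) := by
  simp only [exclusionRate, mul_add, Finset.sum_add_distrib, Finset.mul_sum]
  congr 1
  · congr 1
    · rw [Finset.sum_comm]
      refine Finset.sum_congr rfl fun i _ => ?_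
      rw [Finset.sum_comm]
      refine Finset.sum_congr rfl fun j _ => ?_
      rw [Finset.sum_eq_single (η ∘ Equiv.swap i j)]
      · simp [eq_comp_swap_iff (η := η), mul_comm]
      · intro ξ _ hξ
        rw [if_neg, mul_zero]
        exact fun h => hξ (eq_comp_swap_iff.1 h.2.2)
      · simp
    · rw [Finset.sum_comm]
      refine Finset.sum_congr rfl fun i _ => ?_
      rw [Finset.sum_eq_single (Function.update η i false)]
      · by_cases h : η i = true
        · have : Function.update η i true = η := by rw [← h, Function.update_eq_self]
          simp [h, this, mul_comm]
        · have : η ≠ Function.update η i true := fun h' => h (by rw [h']; simp)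
          simp [h, this]
      · intro ξ _ hξ
        rw [if_neg, mul_zero]
        rintro ⟨h1, rfl⟩
        exact hξ (by rw [Function.update_idem, ← h1, Function.update_eq_self])
      · simp
  · rw [Finset.sum_comm]
    refine Finset.sum_congr rfl fun i _ => ?_
    rw [Finset.sum_eq_single (Function.update η i true)]
    · by_cases h : η i = false
      · have : Function.update η i false = η := by rw [← h, Function.update_eq_self]
        simp [h, this, mul_comm]
      · have : η ≠ Function.update η i false := fun h' => h (by rw [h']; simp)
        simp [h, this]
    · intro ξ _ hξ
      rw [if_neg, mul_zero]
      rintro ⟨h1, rfl⟩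
      exact hξ (by rw [Function.update_idem, ← h1, Function.update_eq_self])
    · simp

theorem sum_exclusionRate (Q : Fin n → Fin n → ℝ) (b d : Fin n → ℝ) (η : Config n) :
    ∑ ξ, exclusionRate Q b d η ξ =
      (∑ i, ∑ j, Q i j * if η i = true ∧ η j = false then 1 else 0)
      + (∑ i, b i * if η i = false then 1 else 0) + (∑ i, d i * if η i = true then 1 else 0) := by
  simp only [exclusionRate, Finset.sum_add_distrib]
  congr 1
  · congr 1
    · rw [Finset.sum_comm]
      refine Finset.sum_congr rfl fun i _ => ?_
      rw [Finset.sum_comm]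
      refine Finset.sum_congr rfl fun j _ => ?_
      simp only [← and_assoc, ite_and _ (_ = _)]
      by_cases h : η i = true ∧ η j = false <;> simp [h]
    · rw [Finset.sum_comm]
      refine Finset.sum_congr rfl fun i _ => ?_
      by_cases h : η i = false <;> simp [h]
  · rw [Finset.sum_comm]
    refine Finset.sum_congr rfl fun i _ => ?_
    by_cases h : η i = true <;> simp [h]

theorem sum_asepJump_mul (q : ℝ) (Y : Fin (n + 1) → Fin (n + 1) → ℝ) :
    ∑ i, ∑ j, asepJump q i j * Y i j =
      ∑ k : Fin n, (Y k.castSucc k.succ + q * Y k.succ k.castSucc) := by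
  have h1 : ∀ (c : ℝ) (Y : Fin (n + 1) → Fin (n + 1) → ℝ),
      (∑ i : Fin (n + 1), ∑ j : Fin (n + 1), if (j : ℕ) = (i : ℕ) + 1 then c * Y i j else 0) =
        ∑ k : Fin n, c * Y k.castSucc k.succ := by
    intro c Y
    rw [Fin.sum_univ_castSucc]
    have hlast : ∀ j : Fin (n + 1), ¬ (j : ℕ) = (Fin.last n : ℕ) + 1 := fun j => by
      have := j.is_lt; simp only [Fin.val_last]; omega
    simp only [hlast, if_false, Finset.sum_const_zero, add_zero]
    refine Finset.sum_congr rfl fun k _ => ?_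
    rw [Finset.sum_eq_single k.succ]
    · simp
    · intro j _ hj
      rw [if_neg]
      exact fun h => hj (Fin.ext (by simpa using h))
    · simp
  have h2 : ∀ i j : Fin (n + 1), asepJump q i j * Y i j =
      (if (j : ℕ) = i + 1 then 1 * Y i j else 0) + (if (i : ℕ) = j + 1 then q * Y i j else 0) := by
    intro i j
    unfold asepJump
    split_ifs <;> first | omega | ring
  simp only [h2, Finset.sum_add_distrib, h1]
  congr 1
  · simp
  · rw [Finset.sum_comm, h1 q fun i j => Y j i]

theorem sum_boundaryRate_mul (l m : ℝ) (Y : Fin (n + 1) → ℝ) :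
    ∑ i, boundaryRate l m i * Y i = l * Y 0 + m * Y (Fin.last n) := by
  have h1 : ∀ i : Fin (n + 1), boundaryRate l m i * Y i =
      (if i = 0 then l * Y i else 0) + (if i = Fin.last n then m * Y i else 0) := by
    intro i
    have h2 : (i : ℕ) = 0 ↔ i = 0 := by rw [Fin.ext_iff]; rfl
    have h3 : (i : ℕ) + 1 = n + 1 ↔ i = Fin.last n := by rw [Fin.ext_iff]; simp
    simp only [boundaryRate, h2, h3, add_mul, ite_mul, zero_mul]
  simp only [h1, Finset.sum_add_distrib]
  simp

theorem removeNth_castSucc_comp_swap (η : Config (n + 1)) (k : Fin n) :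
    k.castSucc.removeNth (η ∘ Equiv.swap k.castSucc k.succ) = k.succ.removeNth η := by
  funext j
  simp only [Fin.removeNth, Function.comp_apply]
  congr 1
  apply label_injective
  rw [label_swap, label_succAbove, label_succAbove]
  simp only [shift, adjSwap, Fin.val_castSucc, Fin.val_succ]
  split_ifs <;> omega

theorem removeNth_succ_comp_swap (η : Config (n + 1)) (k : Fin n) :
    k.succ.removeNth (η ∘ Equiv.swap k.castSucc k.succ) = k.castSucc.removeNth η := by
  rw [← removeNth_castSucc_comp_swap]
  congr 1
  funext i
  simp

/-- Weights that satisfy the relations of the matrix ansatz are stationary. -/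
theorem balance_of_matrixAnsatz {α β q : ℝ} (f : Config (n + 1) → ℝ) (f' : Config n → ℝ)
    (h0 : ∀ η : Config (n + 1), η 0 = false → α * f η = f' (Fin.removeNth 0 η))
    (h1 : ∀ η : Config (n + 1), η (Fin.last n) = true →
      β * f η = f' (Fin.removeNth (Fin.last n) η))
    (hk : ∀ (η : Config (n + 1)) (k : Fin n), η k.castSucc = true → η k.succ = false →
      f η = q * f (η ∘ Equiv.swap k.castSucc k.succ) +
        f' (k.castSucc.removeNth η) + f' (k.succ.removeNth η)) (η : Config (n + 1)) :
    ∑ ξ, f ξ * asepRate (n + 1) α β 0 0 q ξ η = f η * ∑ ξ, asepRate (n + 1) α β 0 0 q η ξ := by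
  -- The telescoping function: inflow minus outflow across the bond `k` equals `g k.succ - g
  -- k.castSucc`, and the two ends contribute `g 0` and `-g (Fin.last n)`. Everything cancels.
  obtain ⟨g, hg⟩ : ∃ g : Fin (n + 1) → ℝ, g = fun i =>
    if η i = true then f' (i.removeNth η) else - f' (i.removeNth η) := ⟨_, rfl⟩
  have hg' : ∀ i, g i = if η i = true then f' (i.removeNth η) else - f' (i.removeNth η) :=
    fun i => by rw [hg]
  simp only [asepRate, sum_mul_exclusionRate, sum_exclusionRate, sum_asepJump_mul,
    sum_boundaryRate_mul, zero_mul, zero_add, add_zero]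
  rw [mul_add, mul_add]
  have hbulk : ∑ k : Fin n, ((if η k.succ = true ∧ η k.castSucc = false then
        f (η ∘ Equiv.swap k.castSucc k.succ) else 0) +
        q * (if η k.castSucc = true ∧ η k.succ = false then
          f (η ∘ Equiv.swap k.succ k.castSucc) else 0)) -
      f η * ∑ k : Fin n, ((if η k.castSucc = true ∧ η k.succ = false then (1 : ℝ) else 0) +
        q * (if η k.succ = true ∧ η k.castSucc = false then 1 else 0)) =
      g (Fin.last n) - g 0 := by
    have e1 := Fin.sum_univ_castSucc g
    have e2 := Fin.sum_univ_succ g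
    have e3 : g (Fin.last n) - g 0 = ∑ k : Fin n, (g k.succ - g k.castSucc) := by
      rw [Finset.sum_sub_distrib]; linarith
    rw [e3, Finset.mul_sum, ← Finset.sum_sub_distrib]
    refine Finset.sum_congr rfl fun k _ => ?_
    rw [hg', hg', Equiv.swap_comm k.succ]
    cases hc : η k.castSucc <;> cases hs : η k.succ
    -- Equal occupation at both ends of the bond: no jump occurs, and deleting either site gives the
    -- same configuration, so both sides vanish.
    · have hη : η ∘ Equiv.swap k.castSucc k.succ = η := by
        funext i
        by_cases i1 : i = k.castSucc
        · simp [i1, hc, hs]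
        by_cases i2 : i = k.succ
        · simp [i2, hc, hs]
        simp [Equiv.swap_apply_of_ne_of_ne i1 i2]
      have := removeNth_castSucc_comp_swap η k
      rw [hη] at this
      simp [this]
    · have := hk (η ∘ Equiv.swap k.castSucc k.succ) k (by simpa using hs) (by simpa using hc)
      rw [removeNth_castSucc_comp_swap, removeNth_succ_comp_swap] at this
      have hη : (η ∘ Equiv.swap k.castSucc k.succ) ∘ Equiv.swap k.castSucc k.succ = η := by
        funext i; simp
      rw [hη] at this
      simp [this]; ring
    · have := hk η k hc hs
      simp [this]; ring
    · have hη : η ∘ Equiv.swap k.castSucc k.succ = η := by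
        funext i
        by_cases i1 : i = k.castSucc
        · simp [i1, hc, hs]
        by_cases i2 : i = k.succ
        · simp [i2, hc, hs]
        simp [Equiv.swap_apply_of_ne_of_ne i1 i2]
      have := removeNth_castSucc_comp_swap η k
      rw [hη] at this
      simp [this]
  have hfirst : (α * if η 0 = true then f (Function.update η 0 false) else 0) -
      f η * (α * if η 0 = false then 1 else 0) = g 0 := by
    rw [hg']
    cases h : η 0
    · have := h0 η h
      simp only [if_true, Bool.false_eq_true, if_false]; linarith
    · have := h0 (Function.update η 0 false) (by simp)
      rw [Fin.removeNth_update] at this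
      simp [this]
  have hlast : (β * if η (Fin.last n) = false then f (Function.update η (Fin.last n) true) else 0) -
      f η * (β * if η (Fin.last n) = true then 1 else 0) = - g (Fin.last n) := by
    rw [hg']
    cases h : η (Fin.last n)
    · have := h1 (Function.update η (Fin.last n) true) (by simp)
      rw [Fin.removeNth_update] at this
      simp [this]
    · have := h1 η h
      simp only [if_true, Bool.true_eq_false, if_false]; linarith
  linarith

end Stationarity

/-! ### Uniqueness of the stationary distribution -/

section Uniqueness

variable {S : Type*} [Fintype S]

/-- If some state is contained in all nonempty sets of states that the chain cannot leave, then
the stationary distribution is unique. -/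
theorem IsStationaryDistribution.unique {rate : S → S → ℝ} (hrate : ∀ ξ η, 0 ≤ rate ξ η) (e : S)
    (he : ∀ T : Set S, T.Nonempty → (∀ ξ ∈ T, ∀ η, 0 < rate ξ η → η ∈ T) → e ∈ T)
    {μ ν : S → ℝ} (hμ : IsStationaryDistribution rate μ) (hν : IsStationaryDistribution rate ν) :
    μ = ν := by
  obtain ⟨f, hf⟩ : ∃ f : S → ℝ, f = fun η => μ η - ν η := ⟨_, rfl⟩
  have hbal : ∀ η, ∑ ξ, f ξ * rate ξ η = f η * ∑ ξ, rate η ξ := fun η => by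
    simp only [hf, sub_mul, Finset.sum_sub_distrib, hμ.2, hν.2]
  have hsum : ∑ η, f η = 0 := by
    simp only [hf, Finset.sum_sub_distrib, hμ.1.2, hν.1.2, sub_self]
  have hle : ∀ η ∈ Finset.univ, |f η| * ∑ ξ, rate η ξ ≤ ∑ ξ, |f ξ| * rate ξ η := fun η _ => by
    calc |f η| * ∑ ξ, rate η ξ = |∑ ξ, f ξ * rate ξ η| := by
          rw [hbal, abs_mul, abs_of_nonneg (Finset.sum_nonneg fun ξ _ => hrate η ξ)]
      _ ≤ ∑ ξ, |f ξ * rate ξ η| := Finset.abs_sum_le_sum_abs _ _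
      _ = ∑ ξ, |f ξ| * rate ξ η := by simp only [abs_mul, abs_of_nonneg (hrate _ _)]
  -- Summed over all states, both sides of `hle` are equal, so the triangle inequality is an
  -- equality everywhere: `|f|` is balanced too.
  have habs : ∀ η, ∑ ξ, |f ξ| * rate ξ η = |f η| * ∑ ξ, rate η ξ := fun η => by
    refine ((Finset.sum_eq_sum_iff_of_le hle).1 ?_ η (Finset.mem_univ η)).symm
    rw [Finset.sum_comm]
    simp only [Finset.mul_sum]
  -- The support of a non-negative balanced function cannot be left, so it contains `e`. As `|f| +
  -- f` and `|f| - f` cannot both be positive at `e`, one of them is zero; then `f` has constant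
  -- sign and total `0`.
  have key : ∀ g : S → ℝ, (∀ η, 0 ≤ g η) → (∀ η, ∑ ξ, g ξ * rate ξ η = g η * ∑ ξ, rate η ξ) →
      (∃ η, g η ≠ 0) → 0 < g e := by
    rintro g hg hgb ⟨η₀, h₀⟩
    refine he {η | 0 < g η} ⟨η₀, (hg η₀).lt_of_ne' h₀⟩ fun ξ hξ η hr => ?_
    refine (hg η).lt_of_ne' fun h => ?_
    have h1 : 0 < ∑ ξ, g ξ * rate ξ η := Finset.sum_pos'
      (fun ζ _ => mul_nonneg (hg ζ) (hrate _ _)) ⟨ξ, Finset.mem_univ _, mul_pos hξ hr⟩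
    rw [hgb, h, zero_mul] at h1
    exact lt_irrefl _ h1
  have k1 := key (fun η => |f η| + f η) (fun η => by linarith [neg_abs_le (f η)])
    (fun η => by simp only [add_mul, Finset.sum_add_distrib, habs, hbal])
  have k2 := key (fun η => |f η| - f η) (fun η => by linarith [le_abs_self (f η)])
    (fun η => by simp only [sub_mul, Finset.sum_sub_distrib, habs, hbal])
  have hzero : ∀ η, f η = 0 := by
    by_cases h1 : ∃ η, |f η| + f η ≠ 0
    · by_cases h2 : ∃ η, |f η| - f η ≠ 0
      · have a1 := k1 h1
        have a2 := k2 h2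
        rcases abs_cases (f e) with h3 | h3 <;> simp only [h3.1] at a1 a2 <;> linarith
      · push Not at h2
        have h3 : ∀ η ∈ Finset.univ, 0 ≤ f η := fun η _ => by
          linarith [abs_nonneg (f η), h2 η]
        exact fun η => (Finset.sum_eq_zero_iff_of_nonneg h3).1 hsum η (Finset.mem_univ η)
    · push Not at h1
      have h3 : ∀ η ∈ Finset.univ, f η ≤ 0 := fun η _ => by
        linarith [abs_nonneg (f η), h1 η]
      exact fun η => (Finset.sum_eq_zero_iff_of_nonpos h3).1 hsum η (Finset.mem_univ η)
  funext η
  have := hzero η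
  rw [hf] at this
  linarith

variable {n : ℕ}

section

variable {Q : Fin n → Fin n → ℝ} {b d : Fin n → ℝ}

theorem exclusionRate_nonneg (hQ : ∀ i j, 0 ≤ Q i j) (hb : ∀ i, 0 ≤ b i) (hd : ∀ i, 0 ≤ d i)
    (η ξ : Config n) : 0 ≤ exclusionRate Q b d η ξ := by
  refine add_nonneg (add_nonneg (Finset.sum_nonneg fun i _ => Finset.sum_nonneg fun j _ => ?_)
    (Finset.sum_nonneg fun i _ => ?_)) (Finset.sum_nonneg fun i _ => ?_)
  · split_ifs; exacts [hQ i j, le_rfl]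
  · split_ifs; exacts [hb i, le_rfl]
  · split_ifs; exacts [hd i, le_rfl]

theorem exclusionRate_pos_of_jump (hQ : ∀ i j, 0 ≤ Q i j) (hb : ∀ i, 0 ≤ b i)
    (hd : ∀ i, 0 ≤ d i) {η : Config n} {i j : Fin n} (hi : η i = true) (hj : η j = false)
    (hij : 0 < Q i j) : 0 < exclusionRate Q b d η (η ∘ Equiv.swap i j) := by
  have h : ∀ i' j', 0 ≤ if η i' = true ∧ η j' = false ∧
      η ∘ Equiv.swap i j = η ∘ Equiv.swap i' j' then Q i' j' else 0 := fun i' j' => by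
    split_ifs; exacts [hQ _ _, le_rfl]
  refine add_pos_of_pos_of_nonneg (add_pos_of_pos_of_nonneg ?_
    (Finset.sum_nonneg fun i _ => ?_)) (Finset.sum_nonneg fun i _ => ?_)
  · refine Finset.sum_pos' (fun i' _ => Finset.sum_nonneg fun j' _ => h i' j')
      ⟨i, Finset.mem_univ _, Finset.sum_pos' (fun j' _ => h i j') ⟨j, Finset.mem_univ _, ?_⟩⟩
    rwa [if_pos ⟨hi, hj, rfl⟩]
  · split_ifs; exacts [hb _, le_rfl]
  · split_ifs; exacts [hd _, le_rfl]

theorem exclusionRate_pos_of_death (hQ : ∀ i j, 0 ≤ Q i j) (hb : ∀ i, 0 ≤ b i)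
    (hd : ∀ i, 0 ≤ d i) {η : Config n} {i : Fin n} (hi : η i = true) (hdi : 0 < d i) :
    0 < exclusionRate Q b d η (Function.update η i false) := by
  refine add_pos_of_nonneg_of_pos (add_nonneg (Finset.sum_nonneg fun i' _ =>
    Finset.sum_nonneg fun j' _ => ?_) (Finset.sum_nonneg fun i' _ => ?_))
    (Finset.sum_pos' (fun i' _ => ?_) ⟨i, Finset.mem_univ _, ?_⟩)
  · split_ifs; exacts [hQ _ _, le_rfl]
  · split_ifs; exacts [hb _, le_rfl]
  · split_ifs; exacts [hd _, le_rfl]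
  · rwa [if_pos ⟨hi, rfl⟩]

end

theorem asepJump_nonneg {q : ℝ} (hq : 0 ≤ q) (i j : Fin n) : 0 ≤ asepJump q i j := by
  unfold asepJump; split_ifs; exacts [zero_le_one, hq, le_rfl]

theorem boundaryRate_nonneg {l m : ℝ} (hl : 0 ≤ l) (hm : 0 ≤ m) (i : Fin n) :
    0 ≤ boundaryRate l m i := by
  unfold boundaryRate; split_ifs <;> simp [hl, hm, add_nonneg]

/-- A set of configurations that the chain cannot leave contains the empty configuration. -/
theorem empty_mem_of_closed {α β q : ℝ} (hα : 0 ≤ α) (hβ : 0 < β) (hq : 0 ≤ q)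
    (T : Set (Config n)) (hT : T.Nonempty)
    (h : ∀ ξ ∈ T, ∀ η, 0 < asepRate n α β 0 0 q ξ η → η ∈ T) : (fun _ => false) ∈ T := by
  have hQ := asepJump_nonneg (n := n) hq
  have hb := boundaryRate_nonneg (n := n) hα le_rfl
  have hd := boundaryRate_nonneg (n := n) le_rfl hβ.le
  -- The number of moves needed to drive all particles out on the right. The rightmost particle can
  -- always jump right or leave at the end, also for `q = 0`, and either move lowers `Φ`.
  let Φ : Config n → ℕ := fun η => ∑ i, if η i = true then n - (i : ℕ) else 0
  obtain ⟨η, hη, hmin⟩ := T.toFinite.exists_minimalFor Φ T hT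
  suffices hemp : ∀ i, η i = false by rwa [show η = fun _ => false from funext hemp] at hη
  by_contra hne
  push Not at hne
  have hF : (Finset.univ.filter fun i => η i = true).Nonempty := by
    obtain ⟨i, hi⟩ := hne
    exact ⟨i, by simpa using hi⟩
  obtain ⟨i, hi, hmax⟩ := Finset.exists_max_image _ id hF
  simp only [Finset.mem_filter, Finset.mem_univ, true_and, id] at hi hmax
  have hlt : ∀ ξ, 0 < asepRate n α β 0 0 q η ξ → ¬ Φ ξ < Φ η := fun ξ hξ hl =>
    absurd (hmin (h η hη ξ hξ) hl.le) (not_le.2 hl)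
  have hin := i.is_lt
  by_cases hlast : (i : ℕ) + 1 = n
  · refine hlt _ (exclusionRate_pos_of_death hQ hb hd hi ?_) ?_
    · simp only [boundaryRate, if_pos hlast]; split_ifs; all_goals linarith
    · refine Finset.sum_lt_sum (fun j _ => ?_) ⟨i, Finset.mem_univ _, ?_⟩
      · by_cases hj : j = i
        · subst hj; simp
        · simp [Function.update_of_ne hj]
      · simp [hi]
  · obtain ⟨j, hj⟩ : ∃ j : Fin n, (j : ℕ) = i + 1 := ⟨⟨i + 1, by omega⟩, rfl⟩
    have hij : i < j := by rw [Fin.lt_def]; omega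
    have hjv : η j = false := by
      by_contra hj'
      exact absurd (hmax j (by simpa using hj')) (not_le.2 hij)
    refine hlt _ (exclusionRate_pos_of_jump hQ hb hd hi hjv ?_) ?_
    · simp [asepJump, hj]
    · have e : Φ (η ∘ Equiv.swap i j) =
          ∑ k, if η k = true then n - (Equiv.swap i j k : ℕ) else 0 := by
        rw [← Equiv.sum_comp (Equiv.swap i j)]
        simp [Φ]
      rw [e]
      refine Finset.sum_lt_sum (fun k _ => ?_) ⟨i, Finset.mem_univ _, ?_⟩
      · by_cases hki : k = i
        · subst hki; simp only [Equiv.swap_apply_left, hj]; split_ifs; all_goals omega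
        · by_cases hkj : k = j
          · subst hkj; simp [hjv]
          · rw [Equiv.swap_apply_of_ne_of_ne hki hkj]
      · rw [if_pos hi, if_pos hi, Equiv.swap_apply_left]; omega

end Uniqueness

/-! ### Assembling the theorem -/

section Main

variable {n : ℕ}

theorem treeWeight_eq (a b q : ℝ) (p : Fin n → ℕ) : treeWeight a b q p =
    a ^ (Finset.univ.filter fun i => p i = 0).card *
      b ^ (Finset.univ.filter fun i => p i = n + 1).card * q ^ yinYang p := by
  rw [treeWeight, Finset.prod_mul_distrib]
  simp [Finset.prod_ite]

theorem treeWeight_nonneg {a b q : ℝ} (ha : 0 ≤ a) (hb : 0 ≤ b) (hq : 0 ≤ q) (p : Fin n → ℕ) :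
    0 ≤ treeWeight a b q p := by
  rw [treeWeight_eq]; positivity

theorem configWeight_nonneg {a b q : ℝ} (ha : 0 ≤ a) (hb : 0 ≤ b) (hq : 0 ≤ q) (η : Config n) :
    0 ≤ configWeight a b q η :=
  Finset.sum_nonneg fun p _ => treeWeight_nonneg ha hb hq p

/-- The star, with every vertex attached to `0`, has no yin-yang pairs and weight `a ^ n`, so it
counts even for `q = 0`. -/
theorem sum_configWeight_pos {a b q : ℝ} (ha : 0 < a) (hb : 0 ≤ b) (hq : 0 ≤ q) :
    0 < ∑ η : Config n, configWeight a b q η := by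
  have h0 : IsAlternating fun _ : Fin n => 0 := fun i =>
    ⟨Nat.zero_le _, by simp [label], fun j hj => by simp [label] at hj⟩
  refine Finset.sum_pos' (fun η _ => configWeight_nonneg ha.le hb hq η)
    ⟨ascents fun _ => 0, Finset.mem_univ _, Finset.sum_pos'
      (fun p _ => treeWeight_nonneg ha.le hb hq p) ⟨fun _ => 0, ?_, ?_⟩⟩
  · simpa [mem_alternatingTrees] using h0
  · have hy : yinYang (fun _ : Fin n => 0) = 0 := by simp [yinYang]
    rw [treeWeight_eq, hy]
    simp; positivity

theorem isStationaryDistribution_configWeight {α β q : ℝ} (hα : 0 < α) (hβ : 0 < β)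
    (hq : 0 ≤ q) : IsStationaryDistribution (asepRate n α β 0 0 q) fun η =>
      configWeight (1 / α) (1 / β) q η / ∑ ξ : Config n, configWeight (1 / α) (1 / β) q ξ := by
  have ha : 0 < 1 / α := by positivity
  have hb : 0 < 1 / β := by positivity
  have hZ := sum_configWeight_pos (n := n) ha hb.le hq
  refine ⟨⟨fun η => div_nonneg (configWeight_nonneg ha.le hb.le hq η) hZ.le, ?_⟩, fun η => ?_⟩
  · rw [← Finset.sum_div, div_self hZ.ne']
  · simp only [div_mul_eq_mul_div, ← Finset.sum_div]
    congr 1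
    cases n with
    | zero =>
      rw [Fintype.sum_subsingleton _ η, Fintype.sum_subsingleton _ η]
    | succ n =>
      refine balance_of_matrixAnsatz _ (configWeight (1 / α) (1 / β) q) (fun η h => ?_)
        (fun η h => ?_) (fun η k h h' => configWeight_of_occupied_vacant _ _ _ η k h h') η
      · rw [configWeight_of_first_vacant _ _ _ η h]; field_simp
      · rw [configWeight_of_last_occupied _ _ _ η h]; field_simp

open MvPolynomial in
-- Summation over the fibres of `parent`: the fibre size supplies `1 / r` per zero cycle and `(r -
-- 1) / r` per non-zero cycle, and what remains of the weights is `1 / α` and `1 / β`.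
theorem sum_coloredPerm_eq {r : ℕ} [NeZero r] (hr : 2 ≤ r) {α β q : ℝ} :
    ∑ π : ColoredPerm r n, C ((r / α) ^ π.zc * (r / ((r - 1) * β)) ^ π.nc * q ^ π.yy) *
        ∏ i ∈ π.excedances, X i =
      C ((r : ℝ) ^ n) * ∑ η : Config n, C (configWeight (1 / α) (1 / β) q η) *
        ∏ i, (X i : MvPolynomial (Fin n) ℝ) ^ (η i).toNat := by
  have hr0 : (r : ℝ) ≠ 0 := Nat.cast_ne_zero.2 (NeZero.ne r)
  have hr1 : (r : ℝ) - 1 ≠ 0 := by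
    have : (2 : ℝ) ≤ r := by exact_mod_cast hr
    linarith
  let M : Config n → MvPolynomial (Fin n) ℝ := fun η => ∏ i, X i ^ (η i).toNat
  let G : (Fin n → ℕ) → MvPolynomial (Fin n) ℝ := fun p =>
    C (treeWeight (r / α) (r / ((r - 1) * β)) q p) * M (ascents p)
  have hG : ∀ π : ColoredPerm r n, C ((r / α) ^ π.zc * (r / ((r - 1) * β)) ^ π.nc * q ^ π.yy) *
      ∏ i ∈ π.excedances, X i = G (parent π) := fun π => by
    simp only [G, M, treeWeight_eq, zc_eq_card_parent, nc_eq_card_parent]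
    congr 1
    rw [← Finset.prod_subset (Finset.subset_univ π.excedances)]
    · refine Finset.prod_congr rfl fun i hi => ?_
      rw [mem_excedances_iff] at hi
      simp [ascents, hi]
    · intro i _ hi
      rw [mem_excedances_iff] at hi
      simp [ascents, hi]
  have hfib : ∀ p ∈ alternatingTrees n,
      ∑ π ∈ Finset.univ.filter fun π : ColoredPerm r n => parent π = p, G (parent π) =
        C ((r : ℝ) ^ n) * (C (treeWeight (1 / α) (1 / β) q p) * M (ascents p)) := by
    intro p hp
    obtain ⟨π, rfl⟩ := (mem_alternatingTrees.1 hp).exists_parent_eq hr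
    rw [Finset.sum_congr rfl fun π' hπ' => by rw [(Finset.mem_filter.1 hπ').2],
      Finset.sum_const, nsmul_eq_mul, ← mul_assoc, ← mul_assoc, ← C_mul]
    congr 1
    rw [← map_natCast (C : ℝ →+* MvPolynomial (Fin n) ℝ), ← C_mul, card_filter_parent_eq,
      treeWeight_eq, treeWeight_eq, ← zc_eq_card_parent, ← nc_eq_card_parent]
    congr 1
    have e1 : (1 / α : ℝ) = 1 / r * (r / α) := by field_simp
    have e2 : (1 / β : ℝ) = (r - 1) / r * (r / ((r - 1) * β)) := by field_simp
    rw [e1, e2, mul_pow, mul_pow]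
    ring
  rw [Finset.sum_congr rfl fun π _ => hG π, ← Finset.sum_fiberwise_of_maps_to
    (fun π _ => mem_alternatingTrees.2 (isAlternating_parent π)), Finset.sum_congr rfl hfib,
    ← Finset.mul_sum, ← Finset.sum_fiberwise (alternatingTrees n) ascents]
  congr 1
  refine Finset.sum_congr rfl fun η _ => ?_
  rw [configWeight, map_sum, Finset.sum_mul]
  refine Finset.sum_congr rfl fun p hp => ?_
  rw [(Finset.mem_filter.1 hp).2]

end Main

/-- The stationary distribution of the ASEP on `n` sites with `γ = δ = 0` and colored
permutations. -/
theorem mainTheorem1 (n r : ℕ) [NeZero r] (hr : 2 ≤ r) (q : ℝ) (hq : 0 ≤ q) :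
    (∀ α β : ℝ, 0 < α → 0 < β →
      (∃! μ : Config n → ℝ, IsStationaryDistribution (asepRate n α β 0 0 q) μ) ∧
      ∀ μ : Config n → ℝ, IsStationaryDistribution (asepRate n α β 0 0 q) μ →
        ∃ c : ℝ, partitionFunction μ = MvPolynomial.C c *
          ∑ π : ColoredPerm r n,
            MvPolynomial.C ((r / α) ^ π.zc * (r / ((r - 1) * β)) ^ π.nc * q ^ π.yy) *
              ∏ i ∈ π.excedances, MvPolynomial.X i) ∧
    (∀ μ : Config n → ℝ, IsStationaryDistribution (asepRate n r (r / (r - 1)) 0 0 q) μ →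
        ∃ c : ℝ, partitionFunction μ = MvPolynomial.C c * qColoredEulerian r n q) ∧
    qColoredEulerian r n 1 = coloredEulerian r n := by
  have hr0 : (0 : ℝ) < r := by positivity
  have hr1 : (0 : ℝ) < r - 1 := by
    have : (2 : ℝ) ≤ r := by exact_mod_cast hr
    linarith
  have main : ∀ α β : ℝ, 0 < α → 0 < β →
      (∃! μ : Config n → ℝ, IsStationaryDistribution (asepRate n α β 0 0 q) μ) ∧
      ∀ μ : Config n → ℝ, IsStationaryDistribution (asepRate n α β 0 0 q) μ →
        ∃ c : ℝ, partitionFunction μ = MvPolynomial.C c *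
          ∑ π : ColoredPerm r n,
            MvPolynomial.C ((r / α) ^ π.zc * (r / ((r - 1) * β)) ^ π.nc * q ^ π.yy) *
              ∏ i ∈ π.excedances, MvPolynomial.X i := by
    intro α β hα hβ
    have h0 := isStationaryDistribution_configWeight (n := n) hα hβ hq
    have huniq : ∀ μ : Config n → ℝ, IsStationaryDistribution (asepRate n α β 0 0 q) μ → μ = _ :=
      fun μ hμ => hμ.unique (exclusionRate_nonneg (asepJump_nonneg hq)
        (boundaryRate_nonneg hα.le le_rfl) (boundaryRate_nonneg le_rfl hβ.le)) (fun _ => false)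
        (empty_mem_of_closed hα.le hβ hq) h0
    refine ⟨⟨_, h0, huniq⟩, fun μ hμ => ?_⟩
    -- The first factor normalizes the tree weights to a probability; the second removes the `r ^ n`
    -- from the fibre sizes.
    refine ⟨(∑ ξ : Config n, configWeight (1 / α) (1 / β) q ξ)⁻¹ * ((r : ℝ) ^ n)⁻¹, ?_⟩
    rw [sum_coloredPerm_eq hr, ← mul_assoc, ← MvPolynomial.C_mul, mul_assoc,
      inv_mul_cancel₀ (pow_ne_zero _ hr0.ne'), mul_one, Finset.mul_sum, huniq μ hμ,
      partitionFunction]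
    refine Finset.sum_congr rfl fun η _ => ?_
    rw [← mul_assoc, ← MvPolynomial.C_mul, div_eq_inv_mul]
  refine ⟨main, fun μ hμ => ?_, ?_⟩
  · obtain ⟨c, hc⟩ := (main r (r / (r - 1)) hr0 (div_pos hr0 hr1)).2 μ hμ
    refine ⟨c, ?_⟩
    have e : ((r : ℝ) - 1) * (r / (r - 1)) = r := by field_simp
    simpa only [e, div_self hr0.ne', one_pow, one_mul, qColoredEulerian] using hc
  · simp [qColoredEulerian, coloredEulerian]
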